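/- **Finslerian version of Schur's lemma for dimension $n>1$.** Let $M$ be a smooth connected manifold of dimension $n>1$, $T_0M$ its slit tangent bundle, $\mathcal C$ the Liouville vector field and $J$ the vertical endomorphism of $TM$. A spray is a smooth vector field $S$ on $T_0M$ with $JS=\mathcal C$ and $[\mathcal C,S]=S$. With Frölicher--Nijenhuis brackets, put $h=\frac12(\mathrm{Id}-[S,J])$, $v=\frac12(\mathrm{Id}+[S,J])$, $\Phi=v\circ[S,h]$, $R=\frac12[h,h]$ and $\rho=\frac1{n-1}\operatorname{Tr}\Phi$ (semi-basic trace). For a vector-valued 1-form $K$ put $d_Kf=df\circ K$ on functions and $d_K\xi=i_Kd\xi-d\,i_K\xi$ on 1-forms. The spray $S$ is *isotropic* if $\Phi=\rho J-\alpha\otimes\mathcal C$ for some smooth semi-basic 1-form $\alpha$ on $T_0M$. A *curvature 1-form* of $S$ is a smooth semi-basic 1-form $\xi$ on $T_0M$, positively homogeneous of degree 1 in the sense that its components $\xi_i(x,y)$ in induced coordinates satisfy $\xi_i(x,ty)=t\,\xi_i(x,y)$ for $t>0$, such that $$R=\xi\wedge J-d_J\xi\otimes\mathcal C .$$ Let $F:TM\to\mathbb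 R$ be a Finsler metric: $F$ is smooth and positive on $T_0M$, positively 1-homogeneous, and the fibrewise Hessian of $\frac12F^2$ is positive definite on $T_0M$. Let $S$ be its geodesic spray, i.e. the spray with $i_S\,dd_J(\frac12F^2)=-d(\frac12F^2)$ on $T_0M$. The metric $F$ has *constant flag curvature* if there is a constant $\kappa\in\mathbb R$ with $\Phi=\kappa\,(F^2J-F\,d_JF\otimes\mathcal C)$ on $T_0M$. Then: 1. If $S$ is isotropic, it has exactly one curvature 1-form $\xi$. 2. $F$ has constant flag curvature if and only if $S$ is isotropic and its curvature 1-form satisfies $d_J\xi=0$ and $d_h\xi=0$. 3. If $n=2$, then $S$ is isotropic. 4. If $n>2$, then every curvature 1-form $\xi$ of $S$ satisfies $d_h\xi=0$. -/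

import Mathlib

open Set Module VectorField
open scoped Manifold ContDiff

noncomputable section

namespace Finsler

/-! ### Tensor calculus on open subsets of a normed space `W`

Vector fields, endomorphism fields (vector-valued 1-forms) and 1-forms are functions on `W`.
Tensors are evaluated on fixed vectors `X Y : W`, extended as constant fields, whose mutual
Lie bracket is zero. -/

section Calculus

variable {W : Type*} [NormedAddCommGroup W] [NormedSpace ℝ W]

/-- The Frölicher-Nijenhuis bracket `[S, K]` of a vector field `S` and an endomorphism field `K`,
`[S, K] X = [S, K X] - K [S, X]`, written out with `X` constant (see `vecEndoBracket_apply`). -/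
def vecEndoBracket (S : W → W) (K : W → W →L[ℝ] W) (z : W) : W →L[ℝ] W :=
  fderiv ℝ K z (S z) - (fderiv ℝ S z).comp (K z) + (K z).comp (fderiv ℝ S z)

theorem vecEndoBracket_apply (S : W → W) (K : W → W →L[ℝ] W) (z : W)
    (hK : DifferentiableAt ℝ K z) (X : W) :
    vecEndoBracket S K z X
      = lieBracket ℝ S (fun w => K w X) z - K z (lieBracket ℝ S (fun _ => X) z) := by
  have h : fderiv ℝ (fun w => K w X) z (S z) = fderiv ℝ K z (S z) X := by
    rw [fderiv_clm_apply hK (differentiableAt_const X)]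
    simp
  simp [vecEndoBracket, lieBracket, h]

/-- The Frölicher-Nijenhuis bracket `[K, L]` of two endomorphism fields,
`[K, L](X, Y) = [KX, LY] + [LX, KY] + (KL + LK)[X, Y] - K[LX, Y] - K[X, LY] - L[KX, Y] - L[X, KY]`,
for constant `X`, `Y` (so that `[X, Y] = 0`). -/
def endoBracket (K L : W → W →L[ℝ] W) (z X Y : W) : W :=
  lieBracket ℝ (fun w => K w X) (fun w => L w Y) z
    + lieBracket ℝ (fun w => L w X) (fun w => K w Y) z
    - K z (lieBracket ℝ (fun w => L w X) (fun _ => Y) z)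
    - K z (lieBracket ℝ (fun _ => X) (fun w => L w Y) z)
    - L z (lieBracket ℝ (fun w => K w X) (fun _ => Y) z)
    - L z (lieBracket ℝ (fun _ => X) (fun w => K w Y) z)

/-- The exterior derivative `dθ` of a 1-form. -/
def extD (θ : W → W →L[ℝ] ℝ) (z X Y : W) : ℝ :=
  fderiv ℝ θ z X Y - fderiv ℝ θ z Y X

/-- The 1-form `d_K f = df ∘ K`. -/
def dFun (K : W → W →L[ℝ] W) (f : W → ℝ) (z : W) : W →L[ℝ] ℝ :=
  (fderiv ℝ f z).comp (K z)

/-- The 2-form `d_K θ = i_K dθ - d i_K θ` of a 1-form `θ`. -/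
def dForm (K : W → W →L[ℝ] W) (θ : W → W →L[ℝ] ℝ) (z X Y : W) : ℝ :=
  extD θ z (K z X) Y + extD θ z X (K z Y) - extD (fun w => (θ w).comp (K w)) z X Y

end Calculus

/-! ### Geometry of a spray on the tangent bundle of an open subset of `E`

Points and tangent vectors of the tangent bundle are pairs `(x, y)` and `(u, w)` in `E × E`. -/

section Local

variable {E : Type*} [NormedAddCommGroup E] [NormedSpace ℝ E]

/-- The vertical endomorphism `J (u, w) = (0, u)`. -/
def vertJ (_z : E × E) : E × E →L[ℝ] E × E :=
  (ContinuousLinearMap.inr ℝ E E).comp (ContinuousLinearMap.fst ℝ E E)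

/-- The Liouville vector field `C (x, y) = (0, y)`. -/
def liouville (z : E × E) : E × E := (0, z.2)

/-- The horizontal projector `h = (Id - [S, J]) / 2`. -/
def horProj (S : E × E → E × E) (z : E × E) : E × E →L[ℝ] E × E :=
  (1 / 2 : ℝ) • (ContinuousLinearMap.id ℝ (E × E) - vecEndoBracket S vertJ z)

/-- The vertical projector `v = (Id + [S, J]) / 2`. -/
def verProj (S : E × E → E × E) (z : E × E) : E × E →L[ℝ] E × E :=
  (1 / 2 : ℝ) • (ContinuousLinearMap.id ℝ (E × E) + vecEndoBracket S vertJ z)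

/-- The Jacobi endomorphism `Φ = v ∘ [S, h]`. -/
def jacobiEndo (S : E × E → E × E) (z : E × E) : E × E →L[ℝ] E × E :=
  (verProj S z).comp (vecEndoBracket S (horProj S) z)

/-- The curvature `R = [h, h] / 2`. -/
def curvature (S : E × E → E × E) (z X Y : E × E) : E × E :=
  (1 / 2 : ℝ) • endoBracket (horProj S) (horProj S) z X Y

/-- The semi-basic trace of a semi-basic endomorphism `(u, w) ↦ (0, A u)`, namely the trace
of `A`. -/
def semibasicTrace (K : E × E →L[ℝ] E × E) : ℝ :=
  LinearMap.trace ℝ E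
    (((ContinuousLinearMap.snd ℝ E E).comp (K.comp (ContinuousLinearMap.inl ℝ E E)) :
      E →L[ℝ] E) : E →ₗ[ℝ] E)

/-- The Ricci scalar `ρ = Tr Φ / (n - 1)`. -/
def ricciScalar (S : E × E → E × E) (z : E × E) : ℝ :=
  semibasicTrace (jacobiEndo S z) / ((finrank ℝ E : ℝ) - 1)

end Local

/-! ### Objects on the slit tangent bundle of a manifold `M`

Functions, vector fields and 1-forms are given on all of `TM`, but all conditions concern only the
slit tangent bundle. Tensorial identities are expressed in the charts of `TM` induced by the
charts of `M`. -/

section Global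

variable {E : Type*} [NormedAddCommGroup E] [NormedSpace ℝ E]
  {M : Type*} [TopologicalSpace M] [ChartedSpace E M] [IsManifold 𝓘(ℝ, E) ∞ M]

variable (E M) in
/-- The slit tangent bundle, as a subset of `TM`. -/
def slit : Set (TangentBundle 𝓘(ℝ, E) M) := {p | p.2 ≠ 0}

variable (E M) in
/-- Vector fields on `TM`. -/
abbrev VecField : Type _ :=
  (p : TangentBundle 𝓘(ℝ, E) M) → TangentSpace 𝓘(ℝ, E).tangent p

variable (E M) in
/-- 1-forms on `TM`. -/
abbrev OneForm : Type _ :=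
  (p : TangentBundle 𝓘(ℝ, E) M) → (TangentSpace 𝓘(ℝ, E).tangent p →L[ℝ] ℝ)

variable (E) in
/-- The chart of `TM` induced by the chart of `M` at `a`. Its source is the part of `TM` over the
domain of that chart, and its target is an open subset of `E × E`. -/
def tChart (a : M) : PartialEquiv (TangentBundle 𝓘(ℝ, E) M) (E × E) :=
  extChartAt 𝓘(ℝ, E).tangent (⟨a, 0⟩ : TangentBundle 𝓘(ℝ, E) M)

variable (E) in
/-- The image of the slit tangent bundle in the induced chart at `a`. -/
def slitTarget (a : M) : Set (E × E) := {z | z ∈ (tChart E a).target ∧ z.2 ≠ 0}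

/-- A function on `TM`, read in the induced chart at `a`. -/
def locFun (F : TangentBundle 𝓘(ℝ, E) M → ℝ) (a : M) (z : E × E) : ℝ :=
  F ((tChart E a).symm z)

/-- A vector field on `TM`, read in the induced chart at `a`. -/
def locVec (S : VecField E M) (a : M) (z : E × E) : E × E :=
  mfderiv 𝓘(ℝ, E).tangent 𝓘(ℝ, E × E) (tChart E a) ((tChart E a).symm z)
    (S ((tChart E a).symm z))

/-- A 1-form on `TM`, read in the induced chart at `a`. -/
def locForm (θ : OneForm E M) (a : M) (z : E × E) : E × E →L[ℝ] ℝ :=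
  (θ ((tChart E a).symm z)).comp
    (mfderiv 𝓘(ℝ, E × E) 𝓘(ℝ, E).tangent (tChart E a).symm z)

/-- A Finsler metric: smooth and positive on the slit tangent bundle, positively 1-homogeneous,
with positive definite fundamental tensor (the fibrewise Hessian of `F ^ 2 / 2`). -/
structure IsFinslerMetric (F : TangentBundle 𝓘(ℝ, E) M → ℝ) : Prop where
  smooth : ContMDiffOn 𝓘(ℝ, E).tangent 𝓘(ℝ, ℝ) ∞ F (slit E M)
  pos : ∀ p ∈ slit E M, 0 < F p
  homogeneous : ∀ (x : M) (y : TangentSpace 𝓘(ℝ, E) x) (t : ℝ), 0 ≤ t →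
    F ⟨x, t • y⟩ = t * F ⟨x, y⟩
  posDef : ∀ a : M, ∀ z ∈ slitTarget E a, ∀ u : E, u ≠ 0 →
    0 < fderiv ℝ (fderiv ℝ (fun w => locFun F a w ^ 2 / 2)) z (0, u) (0, u)

/-- A spray: a smooth vector field on the slit tangent bundle with `JS = C` and `[C, S] = S`. -/
structure IsSpray (S : VecField E M) : Prop where
  smooth : ContMDiffOn 𝓘(ℝ, E).tangent 𝓘(ℝ, E).tangent.tangent ∞
    (fun p => (⟨p, S p⟩ : TangentBundle 𝓘(ℝ, E).tangent (TangentBundle 𝓘(ℝ, E) M))) (slit E M)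
  vert : ∀ a : M, ∀ z ∈ slitTarget E a, vertJ z (locVec S a z) = liouville z
  homogeneous : ∀ a : M, ∀ z ∈ slitTarget E a,
    lieBracket ℝ liouville (locVec S a) z = locVec S a z

/-- `S` is the geodesic spray of `F`: the spray with `i_S d d_J L = - dL`, where
`L = F ^ 2 / 2`. -/
structure IsGeodesicSpray (F : TangentBundle 𝓘(ℝ, E) M → ℝ) (S : VecField E M) : Prop where
  isSpray : IsSpray S
  eulerLagrange : ∀ a : M, ∀ z ∈ slitTarget E a, ∀ X : E × E,
    extD (dFun vertJ (fun w => locFun F a w ^ 2 / 2)) z (locVec S a z) X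
      = - fderiv ℝ (fun w => locFun F a w ^ 2 / 2) z X

/-- A smooth semi-basic 1-form on the slit tangent bundle: it vanishes on vertical vectors. -/
structure IsSemibasic (θ : OneForm E M) : Prop where
  smooth : ∀ a : M, ContDiffOn ℝ ∞ (locForm θ a) (slitTarget E a)
  vert : ∀ a : M, ∀ z ∈ slitTarget E a, ∀ w : E, locForm θ a z (0, w) = 0

/-- `S` is isotropic: `Φ = ρ J - α ⊗ C` for a semi-basic 1-form `α`. -/
def IsIsotropic (S : VecField E M) : Prop :=
  ∃ α : OneForm E M, IsSemibasic α ∧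
    ∀ a : M, ∀ z ∈ slitTarget E a, ∀ X : E × E,
      jacobiEndo (locVec S a) z X
        = ricciScalar (locVec S a) z • vertJ z X - locForm α a z X • liouville z

/-- `ξ` is the curvature 1-form of `S`: the positively 1-homogeneous semi-basic 1-form with
`R = ξ ∧ J - d_J ξ ⊗ C`. -/
structure IsCurvatureForm (S : VecField E M) (ξ : OneForm E M) : Prop where
  semibasic : IsSemibasic ξ
  homogeneous : ∀ a : M, ∀ z ∈ slitTarget E a, ∀ t : ℝ, 0 < t → ∀ u : E,
    locForm ξ a (z.1, t • z.2) (u, 0) = t * locForm ξ a z (u, 0)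
  curvature_eq : ∀ a : M, ∀ z ∈ slitTarget E a, ∀ X Y : E × E,
    curvature (locVec S a) z X Y
      = (locForm ξ a z X • vertJ z Y - locForm ξ a z Y • vertJ z X)
        - dForm vertJ (locForm ξ a) z X Y • liouville z

/-- `d_J ξ = 0` on the slit tangent bundle. -/
def DJVanishes (ξ : OneForm E M) : Prop :=
  ∀ a : M, ∀ z ∈ slitTarget E a, ∀ X Y : E × E, dForm vertJ (locForm ξ a) z X Y = 0

/-- `d_h ξ = 0` on the slit tangent bundle, where `h` is the horizontal projector of `S`. -/
def DHVanishes (S : VecField E M) (ξ : OneForm E M) : Prop :=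
  ∀ a : M, ∀ z ∈ slitTarget E a, ∀ X Y : E × E,
    dForm (horProj (locVec S a)) (locForm ξ a) z X Y = 0

/-- `F`, with geodesic spray `S`, has constant flag curvature:
`Φ = κ (F ^ 2 J - F d_J F ⊗ C)` for a constant `κ`. -/
def HasConstantFlagCurvature (F : TangentBundle 𝓘(ℝ, E) M → ℝ) (S : VecField E M) : Prop :=
  ∃ κ : ℝ, ∀ a : M, ∀ z ∈ slitTarget E a, ∀ X : E × E,
    jacobiEndo (locVec S a) z X
      = κ • (locFun F a z ^ 2 • vertJ z X
          - (locFun F a z * dFun vertJ (locFun F a) z X) • liouville z)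

end Global

end Finsler

end

/-!
In an induced chart write `S (x, y) = (y, g (x, y))`, with horizontal lifts
`hor z u = (u, g_y u / 2)`. The curvature is then `R (X, Y) = (0, curv u v)`, where `u`, `v` are the
base components of `X`, `Y`, and `curv u v = (D²g (hor u, (0, v)) - D²g (hor v, (0, u))) / 2`. The
Jacobi endomorphism is its contraction with the spray, `Φ = i_S R`, and
conversely `[J, Φ] = 3 R` (`IsLocalSpray.three_smul_curv`). Everything is derived from these
expressions, from Euler's relations, and from the symmetry of second and third derivatives.

*Existence and uniqueness.* If `Φ = ρ J - α ⊗ C`, then `Φ S = 0` gives `ρ = α (S)`, and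
`3 R = [J, Φ]` shows that `ξ = (α + d_J ρ) / 3` is a curvature form; its homogeneity comes out of
contracting `R = ξ ∧ J - d_J ξ ⊗ C` with `S` (`representsCurv_of_isotropic`,
`isEulerForm_of_isotropic`). The difference `η` of two curvature forms satisfies `η (S) = 0`, and
then `- η = 2 η` (`RepresentsCurv.unique`).

*Schur's lemma.* The Bianchi identity `[h, R] = 0` becomes `d_h ξ ∧ J = d_h d_J ξ ⊗ C`
(`RepresentsCurv.bianchi`). If `n > 2`, inserting `S` gives first `i_S d_h ξ = 0` and then, since
`d_h d_J = - d_J d_h` and `d_h ξ` is 1-homogeneous, `d_h ξ = - 3 d_h ξ`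
(`RepresentsCurv.dh_eq_zero`).

*Constant flag curvature.* Let `L = F ^ 2 / 2`. Differentiating the Euler-Lagrange equation
vertically gives `d_h d_J L = 0`, hence `d_h L = 0` and `d_R L = 0`. If the flag curvature is the
constant `κ`, then `ξ = κ d_J L` is a curvature form with `d_J ξ = d_h ξ = 0`. Conversely, if
`d_J ξ = 0` then `d_R L = 0` makes `ξ = k d_J L`, with `k` independent of `y`; now `d_h ξ = 0` reads
`dk ∧ d_J L = 0`, which forces `dk = 0` (`IsLocalEnergy.fderiv_factor`). As the slit tangent bundle
is connected, `k` is constant.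

*Dimension two.* `Φ S = 0` and `d_J L ∘ Φ = 0` determine an endomorphism of a plane up to its trace,
so that `Φ = ρ J - (ρ / 2 L) d_J L ⊗ C` (`IsLocalEnergy.curv_of_finrank_eq_two`).

The forms `ξ` and `α` constructed in charts are glued to forms on `TM`. This needs the naturality of
their ingredients under changes of charts, in particular that of the trace of `Φ`
(`vecEndoBracket_natural`).
-/

noncomputable section

namespace Finsler

/-! ### Symmetry of derivatives; the curvature of a spray in coordinates -/

section Calc

variable {W V : Type*} [NormedAddCommGroup W] [NormedSpace ℝ W]
  [NormedAddCommGroup V] [NormedSpace ℝ V] {U : Set W}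

theorem fderiv_eq_of_eqOn {f k : W → V} (hU : IsOpen U) (h : ∀ z ∈ U, f z = k z) {z : W}
    (hz : z ∈ U) : fderiv ℝ f z = fderiv ℝ k z :=
  Filter.EventuallyEq.fderiv_eq (Filter.eventuallyEq_of_mem (hU.mem_nhds hz) h)

theorem diffAt_of_smoothOn {f : W → V} (hU : IsOpen U) (h : ContDiffOn ℝ ∞ f U) {z : W}
    (hz : z ∈ U) : DifferentiableAt ℝ f z :=
  (h.contDiffAt (hU.mem_nhds hz)).differentiableAt (by simp)

theorem smoothOn_fderiv {f : W → V} (hU : IsOpen U) (h : ContDiffOn ℝ ∞ f U) :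
    ContDiffOn ℝ ∞ (fderiv ℝ f) U :=
  h.fderiv_of_isOpen hU (by simp)

theorem fderiv_fderiv_symm {f : W → V} (hU : IsOpen U) (h : ContDiffOn ℝ ∞ f U) {z : W}
    (hz : z ∈ U) (X Y : W) :
    fderiv ℝ (fderiv ℝ f) z X Y = fderiv ℝ (fderiv ℝ f) z Y X :=
  (h.contDiffAt (hU.mem_nhds hz)).isSymmSndFDerivAt
    (by simpa using (mod_cast le_top : ((2 : ℕ∞) : WithTop ℕ∞) ≤ ∞)) X Y

/-- The third derivative is symmetric in its last two arguments (in the first two it is by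
`fderiv_fderiv_symm`). -/
theorem fderiv_fderiv_fderiv_symm {f : W → V} (hU : IsOpen U) (h : ContDiffOn ℝ ∞ f U) {z : W}
    (hz : z ∈ U) (X Y Z : W) :
    fderiv ℝ (fderiv ℝ (fderiv ℝ f)) z X Y Z = fderiv ℝ (fderiv ℝ (fderiv ℝ f)) z X Z Y := by
  have hd := diffAt_of_smoothOn hU (smoothOn_fderiv hU (smoothOn_fderiv hU h)) hz
  have key : ∀ A B : W, fderiv ℝ (fun w => fderiv ℝ (fderiv ℝ f) w A B) z X
      = fderiv ℝ (fderiv ℝ (fderiv ℝ f)) z X A B := by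
    intro A B
    rw [fderiv_clm_apply (hd.clm_apply (differentiableAt_const A)) (differentiableAt_const B),
      fderiv_clm_apply hd (differentiableAt_const A)]
    simp
  rw [← key Y Z, ← key Z Y, fderiv_eq_of_eqOn hU (fun w hw => fderiv_fderiv_symm hU h hw Y Z) hz]

theorem fderiv_clm_apply_apply {A : W → W →L[ℝ] V} {v : W → W} {z : W}
    (hA : DifferentiableAt ℝ A z) (hv : DifferentiableAt ℝ v z) (X : W) :
    fderiv ℝ (fun w => A w (v w)) z X = fderiv ℝ A z X (v z) + A z (fderiv ℝ v z X) := by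
  rw [fderiv_clm_apply hA hv]
  simp [add_comm]

theorem fderiv_clm_apply_const {A : W → W →L[ℝ] V} {z : W}
    (hA : DifferentiableAt ℝ A z) (v X : W) :
    fderiv ℝ (fun w => A w v) z X = fderiv ℝ A z X v := by
  rw [fderiv_clm_apply_apply hA (differentiableAt_const v)]
  simp

theorem fderiv_clm_apply_apply₂ {A : W → W →L[ℝ] W →L[ℝ] V} {u v : W → W} {z : W}
    (hA : DifferentiableAt ℝ A z) (hu : DifferentiableAt ℝ u z) (hv : DifferentiableAt ℝ v z)
    (X : W) :
    fderiv ℝ (fun w => A w (u w) (v w)) z X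
      = fderiv ℝ A z X (u z) (v z) + A z (fderiv ℝ u z X) (v z) + A z (u z) (fderiv ℝ v z X) := by
  rw [fderiv_clm_apply_apply (hA.clm_apply hu) hv, fderiv_clm_apply_apply hA hu]
  simp

end Calc

section Spray

variable {E : Type*} [NormedAddCommGroup E] [NormedSpace ℝ E] {U : Set (E × E)}
  {S : E × E → E × E} {z : E × E}

/-- A spray `S (x, y) = (y, g (x, y))` on an open subset `U` of `E × (E ∖ {0})`. The condition
`[C, S] = S` amounts to Euler's relation for the 2-homogeneous function `g`. -/
structure IsLocalSpray (U : Set (E × E)) (S : E × E → E × E) : Prop where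
  isOpen : IsOpen U
  ne_zero : ∀ z ∈ U, z.2 ≠ 0
  smooth : ContDiffOn ℝ ∞ S U
  fst_eq : ∀ z ∈ U, (S z).1 = z.2
  euler : ∀ z ∈ U, fderiv ℝ (fun w => (S w).2) z (0, z.2) = (2 : ℝ) • (S z).2

/-- The derivative of the second component `g` of a spray `S (x, y) = (y, g (x, y))`. -/
def G1 (S : E × E → E × E) : E × E → E × E →L[ℝ] E := fderiv ℝ (fun w => (S w).2)

/-- The second derivative of the second component of a spray. -/
def G2 (S : E × E → E × E) : E × E → E × E →L[ℝ] E × E →L[ℝ] E := fderiv ℝ (G1 S)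

/-- The third derivative of the second component of a spray. -/
def G3 (S : E × E → E × E) : E × E → E × E →L[ℝ] E × E →L[ℝ] E × E →L[ℝ] E :=
  fderiv ℝ (G2 S)

/-- The horizontal lift of `u : E` at `z`. -/
def hor (S : E × E → E × E) (z : E × E) (u : E) : E × E := (u, (1 / 2 : ℝ) • G1 S z (0, u))

/-- The vertical component of the curvature `R` of a spray, a 2-form with values in `E`. -/
def curv (S : E × E → E × E) (z : E × E) (u v : E) : E :=
  (1 / 2 : ℝ) • G2 S z (hor S z u) (0, v) - (1 / 2 : ℝ) • G2 S z (hor S z v) (0, u)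

omit [NormedSpace ℝ E] in
theorem vert_add (u v : E) : ((0, u + v) : E × E) = (0, u) + (0, v) := by simp

theorem vert_smul (c : ℝ) (v : E) : ((0, c • v) : E × E) = c • (0, v) := by simp

theorem hor_eq (S : E × E → E × E) (z : E × E) (u : E) :
    hor S z u = (u, 0) + (1 / 2 : ℝ) • (0, G1 S z (0, u)) := by simp [hor]

theorem hor_smul (c : ℝ) (v : E) : hor S z (c • v) = c • hor S z v := by
  simp only [hor, vert_smul, map_smul, smul_comm (1 / 2 : ℝ) c]
  rfl

theorem hor_zero : hor S z 0 = 0 := by simpa using hor_smul (S := S) (z := z) 0 0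

omit [NormedSpace ℝ E] in
theorem vert_sub (u v : E) : ((0, u - v) : E × E) = (0, u) - (0, v) := by simp

theorem curv_self (u : E) : curv S z u u = 0 := by simp [curv]

namespace IsLocalSpray

variable (h : IsLocalSpray U S)
include h

theorem smooth_snd : ContDiffOn ℝ ∞ (fun w => (S w).2) U := contDiff_snd.comp_contDiffOn h.smooth

theorem smooth_G1 : ContDiffOn ℝ ∞ (G1 S) U := smoothOn_fderiv h.isOpen h.smooth_snd

theorem smooth_G2 : ContDiffOn ℝ ∞ (G2 S) U := smoothOn_fderiv h.isOpen h.smooth_G1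

theorem diffAt (hz : z ∈ U) : DifferentiableAt ℝ S z := diffAt_of_smoothOn h.isOpen h.smooth hz

theorem diffAt_G1 (hz : z ∈ U) : DifferentiableAt ℝ (G1 S) z :=
  diffAt_of_smoothOn h.isOpen h.smooth_G1 hz

theorem diffAt_G2 (hz : z ∈ U) : DifferentiableAt ℝ (G2 S) z :=
  diffAt_of_smoothOn h.isOpen h.smooth_G2 hz

theorem G2_symm (hz : z ∈ U) (X Y : E × E) : G2 S z X Y = G2 S z Y X :=
  fderiv_fderiv_symm h.isOpen h.smooth_snd hz X Y

theorem G3_symm (hz : z ∈ U) (X Y Z : E × E) : G3 S z X Y Z = G3 S z Y X Z :=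
  congrArg (fun A => A Z) (fderiv_fderiv_symm h.isOpen h.smooth_G1 hz X Y)

theorem G3_symm' (hz : z ∈ U) (X Y Z : E × E) : G3 S z X Y Z = G3 S z X Z Y :=
  fderiv_fderiv_fderiv_symm h.isOpen h.smooth_snd hz X Y Z

theorem G1_liouville (hz : z ∈ U) : G1 S z (0, z.2) = (2 : ℝ) • (S z).2 := h.euler z hz

/-- The spray is horizontal. -/
theorem eq_hor (hz : z ∈ U) : S z = hor S z z.2 := by
  ext1
  · simp [hor, h.fst_eq z hz]
  · simp [hor, h.G1_liouville hz]

/-- The derivative of Euler's relation `G1_liouville`. -/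
theorem G2_liouville (hz : z ∈ U) (X : E × E) :
    G2 S z X (0, z.2) = (2 : ℝ) • G1 S z X - G1 S z (0, X.2) := by
  have h1 := congrArg (fun A => A X)
    (fderiv_eq_of_eqOn h.isOpen (fun w hw => h.G1_liouville hw) hz)
  have hv : DifferentiableAt ℝ (fun w : E × E => ((0, w.2) : E × E)) z := by fun_prop
  have hv' : fderiv ℝ (fun w : E × E => ((0, w.2) : E × E)) z X = (0, X.2) := by
    rw [DifferentiableAt.fderiv_prodMk (by fun_prop) (by fun_prop)]
    simp [fderiv_snd]
  rw [fderiv_clm_apply_apply (h.diffAt_G1 hz) hv, hv',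
    fderiv_fun_const_smul (diffAt_of_smoothOn h.isOpen h.smooth_snd hz)] at h1
  rw [eq_sub_iff_add_eq]
  exact h1

theorem fderiv_eq (hz : z ∈ U) (X : E × E) : fderiv ℝ S z X = (X.2, G1 S z X) := by
  have h1 : fderiv ℝ (fun w => ((S w).1, (S w).2)) z X
      = (fderiv ℝ (fun w => (S w).1) z X, fderiv ℝ (fun w => (S w).2) z X) := by
    have := h.diffAt hz
    rw [DifferentiableAt.fderiv_prodMk (by fun_prop) (by fun_prop)]
    rfl
  rw [fderiv_eq_of_eqOn h.isOpen h.fst_eq hz] at h1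
  rw [fderiv_snd] at h1
  exact h1

theorem fderiv_hor (hz : z ∈ U) (u : E) (X : E × E) :
    fderiv ℝ (fun w => hor S w u) z X = (0, (1 / 2 : ℝ) • G2 S z X (0, u)) := by
  have hd := h.diffAt_G1 hz
  have h1 : DifferentiableAt ℝ (fun w => G1 S w (0, u)) z := by fun_prop
  unfold hor
  rw [DifferentiableAt.fderiv_prodMk (by fun_prop) (by fun_prop), fderiv_fun_const_smul h1]
  simp [fderiv_clm_apply_const hd]
  rfl

theorem diffAt_hor (hz : z ∈ U) (u : E) : DifferentiableAt ℝ (fun w => hor S w u) z := by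
  have hd := h.diffAt_G1 hz
  unfold hor
  fun_prop

theorem vecEndoBracket_vertJ (hz : z ∈ U) (X : E × E) :
    vecEndoBracket S vertJ z X = (-X.1, X.2 - G1 S z (0, X.1)) := by
  have h0 : fderiv ℝ (vertJ : E × E → E × E →L[ℝ] E × E) z = 0 := fderiv_const_apply _
  simp [vecEndoBracket, h0, h.fderiv_eq hz, vertJ, sub_eq_add_neg, add_comm]

theorem horProj_apply (hz : z ∈ U) (X : E × E) : horProj S z X = hor S z X.1 := by
  simp only [horProj, _root_.smul_apply, _root_.sub_apply,
    h.vecEndoBracket_vertJ hz, ContinuousLinearMap.id_apply, hor]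
  ext1
  · simp only [Prod.smul_fst, Prod.fst_sub]; module
  · simp

theorem verProj_apply (hz : z ∈ U) (X : E × E) :
    verProj S z X = (0, X.2 - (1 / 2 : ℝ) • G1 S z (0, X.1)) := by
  simp only [verProj, _root_.smul_apply, _root_.add_apply,
    h.vecEndoBracket_vertJ hz, ContinuousLinearMap.id_apply]
  ext1
  · simp
  · simp only [Prod.smul_snd, Prod.snd_add]; module

theorem smooth_horProj : ContDiffOn ℝ ∞ (horProj S) U := by
  have : ContDiffOn ℝ ∞ (fun z => (1 / 2 : ℝ) • (ContinuousLinearMap.id ℝ (E × E)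
      - ((0 : E × E →L[ℝ] E × E) - (fderiv ℝ S z).comp (vertJ z)
        + (vertJ z).comp (fderiv ℝ S z)))) U := by
    have h1 := smoothOn_fderiv h.isOpen h.smooth
    have h2 : ContDiffOn ℝ ∞ (vertJ : E × E → E × E →L[ℝ] E × E) U := contDiffOn_const
    exact (contDiffOn_const.sub
      ((contDiffOn_const.sub (h1.clm_comp h2)).add (h2.clm_comp h1))).const_smul _
  refine this.congr fun z _ => ?_
  have h0 : fderiv ℝ (vertJ : E × E → E × E →L[ℝ] E × E) z = 0 := fderiv_const_apply _
  simp [horProj, vecEndoBracket, h0]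

theorem fderiv_horProj (hz : z ∈ U) (X Y : E × E) :
    fderiv ℝ (horProj S) z Y X = (0, (1 / 2 : ℝ) • G2 S z Y (0, X.1)) := by
  rw [← fderiv_clm_apply_const (diffAt_of_smoothOn h.isOpen h.smooth_horProj hz),
    fderiv_eq_of_eqOn h.isOpen (fun w hw => h.horProj_apply hw X) hz, h.fderiv_hor hz]

theorem curvature_apply (hz : z ∈ U) (X Y : E × E) :
    curvature S z X Y = (0, curv S z X.1 Y.1) := by
  have hd : ∀ X Z : E × E, fderiv ℝ (fun w => horProj S w X) z Z
      = (0, (1 / 2 : ℝ) • G2 S z Z (0, X.1)) := fun X Z => by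
    rw [fderiv_eq_of_eqOn h.isOpen (fun w hw => h.horProj_apply hw X) hz, h.fderiv_hor hz]
  simp only [curvature, endoBracket, lieBracket, hd, h.horProj_apply hz, curv,
    fderiv_fun_const, Pi.zero_apply, _root_.zero_apply, zero_sub, sub_zero,
    Prod.fst_neg, neg_zero, hor_zero]
  ext1
  · simp
  · simp only [Prod.smul_snd, Prod.snd_sub, Prod.snd_add]
    module

/-- The formula `Φ = i_S R`. -/
theorem jacobiEndo_apply (hz : z ∈ U) (X : E × E) :
    jacobiEndo S z X = (0, curv S z z.2 X.1) := by
  simp only [jacobiEndo, vecEndoBracket, ContinuousLinearMap.comp_apply,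
    _root_.add_apply, _root_.sub_apply, h.fderiv_horProj hz,
    h.horProj_apply hz, h.fderiv_eq hz, h.verProj_apply hz, curv, ← h.eq_hor hz,
    h.G2_liouville hz]
  ext1
  · rfl
  · simp only [hor_eq, Prod.snd_add, Prod.snd_sub, Prod.fst_add, Prod.fst_sub, Prod.smul_fst,
      Prod.smul_snd, vert_smul, map_smul, vert_add, vert_sub, map_add, map_sub, smul_zero, zero_add,
      add_zero, Prod.mk_zero_zero, map_zero]
    module

theorem fderiv_curv (hz : z ∈ U) (u v : E) (X : E × E) :
    fderiv ℝ (fun w => curv S w u v) z X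
      = (1 / 2 : ℝ) • (G3 S z X (hor S z u) (0, v)
          + (1 / 2 : ℝ) • G2 S z (0, G2 S z X (0, u)) (0, v))
        - (1 / 2 : ℝ) • (G3 S z X (hor S z v) (0, u)
          + (1 / 2 : ℝ) • G2 S z (0, G2 S z X (0, v)) (0, u)) := by
  have key : ∀ u v : E, DifferentiableAt ℝ (fun w => G2 S w (hor S w u) (0, v)) z ∧
      fderiv ℝ (fun w => G2 S w (hor S w u) (0, v)) z X
      = G3 S z X (hor S z u) (0, v) + (1 / 2 : ℝ) • G2 S z (0, G2 S z X (0, u)) (0, v) := by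
    intro u v
    have hd := h.diffAt_G2 hz
    have hu := h.diffAt_hor hz u
    refine ⟨by fun_prop, ?_⟩
    rw [fderiv_clm_apply_apply₂ hd hu (differentiableAt_const _), h.fderiv_hor hz, vert_smul]
    simp only [map_smul, _root_.smul_apply, fderiv_fun_const, Pi.zero_apply, _root_.zero_apply,
      map_zero, add_zero]
    rfl
  unfold curv
  rw [fderiv_fun_sub ((key u v).1.fun_const_smul _) ((key v u).1.fun_const_smul _),
    fderiv_fun_const_smul (key u v).1, fderiv_fun_const_smul (key v u).1]
  simp only [_root_.sub_apply, _root_.smul_apply, (key u v).2,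
    (key v u).2]

/-- The Bianchi identity `[h, R] = 0`, that is, the Jacobi identity for horizontal lifts. -/
theorem bianchi (hz : z ∈ U) (u v w : E) :
    (fderiv ℝ (fun p => curv S p u v) z (hor S z w) - (1 / 2 : ℝ) • G2 S z (0, w) (0, curv S z u v))
    + (fderiv ℝ (fun p => curv S p v w) z (hor S z u)
        - (1 / 2 : ℝ) • G2 S z (0, u) (0, curv S z v w))
    + (fderiv ℝ (fun p => curv S p w u) z (hor S z v)
        - (1 / 2 : ℝ) • G2 S z (0, v) (0, curv S z w u)) = 0 := by
  have e : ∀ a b c : E, G2 S z (0, c) (0, curv S z a b)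
      = (1 / 2 : ℝ) • G2 S z (0, G2 S z (hor S z a) (0, b)) (0, c)
        - (1 / 2 : ℝ) • G2 S z (0, G2 S z (hor S z b) (0, a)) (0, c) := by
    intro a b c
    rw [h.G2_symm hz, curv, vert_sub, vert_smul, vert_smul, map_sub, map_smul, map_smul]
    rfl
  simp only [h.fderiv_curv hz, e]
  rw [h.G3_symm hz (hor S z u) (hor S z w), h.G3_symm hz (hor S z v) (hor S z w),
    h.G3_symm hz (hor S z u) (hor S z v)]
  module

/-- The formula `[J, Φ] = 3 R`. -/
theorem three_smul_curv (hz : z ∈ U) (u v : E) :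
    (3 : ℝ) • curv S z u v = fderiv ℝ (fun w => curv S w w.2 v) z (0, u)
      - fderiv ℝ (fun w => curv S w w.2 u) z (0, v) := by
  have e : ∀ v : E, ∀ w ∈ U, curv S w w.2 v = (1 / 2 : ℝ) • G2 S w (S w) (0, v) - G1 S w (v, 0)
      - (1 / 4 : ℝ) • G1 S w (0, G1 S w (0, v)) := by
    intro v w hw
    rw [curv, ← h.eq_hor hw, h.G2_liouville hw]
    simp only [hor_eq, map_add, map_smul, Prod.snd_add, Prod.smul_snd, zero_add, vert_smul]
    module
  have hd1 := h.diffAt_G1 hz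
  have hd2 := h.diffAt_G2 hz
  have hdS := h.diffAt hz
  have key : ∀ u v : E, fderiv ℝ (fun w => curv S w w.2 v) z (0, u)
      = (1 / 2 : ℝ) • (G3 S z (S z) (0, u) (0, v) + G2 S z (u, 0) (0, v)
          + G2 S z (0, G1 S z (0, u)) (0, v)) - G2 S z (v, 0) (0, u)
        - (1 / 4 : ℝ) • (G2 S z (0, G1 S z (0, v)) (0, u)
          + G1 S z (0, G2 S z (0, u) (0, v))) := by
    intro u v
    have hv : DifferentiableAt ℝ (fun w => ((0, G1 S w (0, v)) : E × E)) z := by fun_prop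
    have hv' : fderiv ℝ (fun w => ((0, G1 S w (0, v)) : E × E)) z (0, u)
        = (0, G2 S z (0, u) (0, v)) := by
      rw [DifferentiableAt.fderiv_prodMk (by fun_prop) (by fun_prop)]
      simp [fderiv_clm_apply_const hd1]
      rfl
    have a1 : DifferentiableAt ℝ (fun w => G2 S w (S w) (0, v)) z := by fun_prop
    have a2 : DifferentiableAt ℝ (fun w => G1 S w (v, 0)) z := by fun_prop
    have a3 : DifferentiableAt ℝ (fun w => G1 S w (0, G1 S w (0, v))) z := hd1.clm_apply hv
    rw [fderiv_eq_of_eqOn h.isOpen (e v) hz, fderiv_fun_sub ((a1.fun_const_smul _).fun_sub a2)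
      (a3.fun_const_smul _), fderiv_fun_sub (a1.fun_const_smul _) a2, fderiv_fun_const_smul a1,
      fderiv_fun_const_smul a3]
    simp only [_root_.sub_apply, _root_.smul_apply]
    rw [fderiv_clm_apply_apply₂ hd2 hdS (differentiableAt_const _), fderiv_clm_apply_const hd1,
      fderiv_clm_apply_apply hd1 hv, hv', h.fderiv_eq hz]
    have s : ((u, G1 S z (0, u)) : E × E) = (u, 0) + (0, G1 S z (0, u)) := by simp
    have t1 : G3 S z (0, u) (S z) (0, v) = G3 S z (S z) (0, u) (0, v) := h.G3_symm hz _ _ _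
    have t2 : G2 S z (0, u) (v, 0) = G2 S z (v, 0) (0, u) := h.G2_symm hz _ _
    have t3 : G2 S z (0, u) (0, G1 S z (0, v)) = G2 S z (0, G1 S z (0, v)) (0, u) :=
      h.G2_symm hz _ _
    simp only [G3, G2] at t1 t2 t3 ⊢
    rw [s, map_add]
    simp only [fderiv_fun_const, Pi.zero_apply, _root_.zero_apply, map_zero, add_zero,
      _root_.add_apply, t1, t2, t3]
    module
  rw [key, key, h.G3_symm' hz _ (0, v) (0, u), h.G2_symm hz (0, v) (0, u)]
  simp only [curv, hor_eq, map_add, map_smul, _root_.add_apply,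
    _root_.smul_apply]
  module

end IsLocalSpray

end Spray

/-! ### Semi-basic 1-forms representing the curvature -/

section Forms

variable {E : Type*} [NormedAddCommGroup E] [NormedSpace ℝ E] {U : Set (E × E)}
  {S : E × E → E × E} {z : E × E}

/-- A smooth semi-basic 1-form on an open set `U`. -/
structure IsLocalForm (U : Set (E × E)) (θ : E × E → E × E →L[ℝ] ℝ) : Prop where
  isOpen : IsOpen U
  smooth : ContDiffOn ℝ ∞ θ U
  vert : ∀ z ∈ U, ∀ w : E, θ z (0, w) = 0

/-- The components of `d_J θ`, for a semi-basic 1-form `θ`. -/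
def dj (θ : E × E → E × E →L[ℝ] ℝ) (z : E × E) (u v : E) : ℝ :=
  fderiv ℝ θ z (0, u) (v, 0) - fderiv ℝ θ z (0, v) (u, 0)

/-- The components of `d_h θ`, for a semi-basic 1-form `θ`. -/
def dh (S : E × E → E × E) (θ : E × E → E × E →L[ℝ] ℝ) (z : E × E) (u v : E) : ℝ :=
  fderiv ℝ θ z (hor S z u) (v, 0) - fderiv ℝ θ z (hor S z v) (u, 0)

/-- Euler's relation for the components of a positively 1-homogeneous semi-basic 1-form. -/
def IsEulerForm (U : Set (E × E)) (θ : E × E → E × E →L[ℝ] ℝ) : Prop :=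
  ∀ z ∈ U, ∀ v : E, fderiv ℝ θ z (0, z.2) (v, 0) = θ z (v, 0)

/-- The identity `R = θ ∧ J - d_J θ ⊗ C`, in components. -/
def RepresentsCurv (U : Set (E × E)) (S : E × E → E × E) (θ : E × E → E × E →L[ℝ] ℝ) : Prop :=
  ∀ z ∈ U, ∀ u v : E,
    curv S z u v = θ z (u, 0) • v - θ z (v, 0) • u - dj θ z u v • z.2

theorem dh_swap (θ : E × E → E × E →L[ℝ] ℝ) (u v : E) : dh S θ z u v = - dh S θ z v u := by
  simp [dh]

namespace IsLocalForm

variable {θ : E × E → E × E →L[ℝ] ℝ} (hθ : IsLocalForm U θ)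
include hθ

theorem diffAt (hz : z ∈ U) : DifferentiableAt ℝ θ z := diffAt_of_smoothOn hθ.isOpen hθ.smooth hz

theorem diffAt_fderiv (hz : z ∈ U) : DifferentiableAt ℝ (fderiv ℝ θ) z :=
  diffAt_of_smoothOn hθ.isOpen (smoothOn_fderiv hθ.isOpen hθ.smooth) hz

theorem apply_eq (hz : z ∈ U) (X : E × E) : θ z X = θ z (X.1, 0) := by
  have : X = (X.1, 0) + (0, X.2) := by simp
  conv_lhs => rw [this, map_add, hθ.vert z hz, add_zero]

theorem fderiv_vert (hz : z ∈ U) (X : E × E) (w : E) : fderiv ℝ θ z X (0, w) = 0 := by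
  rw [← fderiv_clm_apply_const (hθ.diffAt hz),
    fderiv_eq_of_eqOn hθ.isOpen (fun p hp => hθ.vert p hp w) hz]
  simp

theorem fderiv_apply_eq (hz : z ∈ U) (X Y : E × E) :
    fderiv ℝ θ z X Y = fderiv ℝ θ z X (Y.1, 0) := by
  have : Y = (Y.1, 0) + (0, Y.2) := by simp
  conv_lhs => rw [this, map_add, hθ.fderiv_vert hz, add_zero]

theorem dForm_vertJ (hz : z ∈ U) (X Y : E × E) : dForm vertJ θ z X Y = dj θ z X.1 Y.1 := by
  have h0 : fderiv ℝ (fun w => (θ w).comp (vertJ w)) z = 0 := by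
    rw [fderiv_eq_of_eqOn (k := fun _ => 0) hθ.isOpen (fun w hw => ?_) hz]
    · simp
    · refine ContinuousLinearMap.ext fun X => ?_
      exact hθ.vert w hw X.1
  simp only [dForm, extD, h0]
  rw [hθ.fderiv_apply_eq hz _ Y, hθ.fderiv_apply_eq hz _ X]
  simp [vertJ, hθ.fderiv_vert hz, dj, sub_eq_add_neg]

theorem dForm_horProj (h : IsLocalSpray U S) (hz : z ∈ U) (X Y : E × E) :
    dForm (horProj S) θ z X Y = dh S θ z X.1 Y.1 := by
  have h0 : fderiv ℝ (fun w => (θ w).comp (horProj S w)) z = fderiv ℝ θ z := by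
    refine fderiv_eq_of_eqOn hθ.isOpen (fun w hw => ?_) hz
    refine ContinuousLinearMap.ext fun X => ?_
    rw [ContinuousLinearMap.comp_apply, h.horProj_apply hw, hθ.apply_eq hw, hθ.apply_eq hw X]
    rfl
  simp only [dForm, extD, h0, h.horProj_apply hz]
  rw [hθ.fderiv_apply_eq hz _ Y, hθ.fderiv_apply_eq hz _ X, hθ.fderiv_apply_eq hz Y,
    hθ.fderiv_apply_eq hz X, hθ.fderiv_apply_eq hz X Y, hθ.fderiv_apply_eq hz Y X]
  simp only [hor, dh]
  ring

/-- The derivative of the contraction `θ (S)` of a semi-basic 1-form with a spray. -/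
theorem fderiv_contract (hz : z ∈ U) (X : E × E) :
    fderiv ℝ (fun w => θ w (w.2, 0)) z X = fderiv ℝ θ z X (z.2, 0) + θ z (X.2, 0) := by
  rw [fderiv_clm_apply_apply (v := fun w : E × E => (w.2, 0)) (hθ.diffAt hz) (by fun_prop),
    DifferentiableAt.fderiv_prodMk (by fun_prop) (by fun_prop)]
  simp [fderiv_snd]

theorem smooth_contract : ContDiffOn ℝ ∞ (fun w => θ w (w.2, 0)) U :=
  hθ.smooth.clm_apply (by fun_prop)

end IsLocalForm

/-- A representing form `θ` determines the Jacobi endomorphism, by contraction with the spray. -/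
theorem RepresentsCurv.curv_snd {θ : E × E → E × E →L[ℝ] ℝ} (hR : RepresentsCurv U S θ)
    (hz : z ∈ U) (v : E) :
    curv S z z.2 v = θ z (z.2, 0) • v - (θ z (v, 0) + dj θ z z.2 v) • z.2 := by
  rw [hR z hz]
  module

/-- In dimension at least two, the decomposition `r • v - b v • y` determines `r` and `b`. -/
theorem eq_of_smul_sub_smul_eq [FiniteDimensional ℝ E] (hn : 1 < finrank ℝ E) {y : E} (hy : y ≠ 0)
    {r r' : ℝ} {b b' : E → ℝ} (e : ∀ v, r • v - b v • y = r' • v - b' v • y) :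
    r = r' ∧ ∀ v, b v = b' v := by
  obtain ⟨v, hv⟩ : ∃ v : E, v ∉ Submodule.span ℝ {y} := by
    by_contra! hc
    have := finrank_span_singleton (K := ℝ) hy
    rw [(Submodule.eq_top_iff'.2 hc), finrank_top] at this
    omega
  have hr : r = r' := by
    by_contra hne
    refine hv (Submodule.mem_span_singleton.2 ⟨(r - r')⁻¹ * (b v - b' v), ?_⟩)
    have e' : (b v - b' v) • y = (r - r') • v := by
      rw [sub_smul, sub_smul, sub_eq_sub_iff_sub_eq_sub, ← neg_inj]
      simpa using e v
    rw [mul_smul, e', smul_smul, inv_mul_cancel₀ (sub_ne_zero.2 hne), one_smul]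
  refine ⟨hr, fun w => ?_⟩
  have e' := e w
  rw [hr, sub_right_inj] at e'
  exact smul_left_injective ℝ hy e'

/-- In dimension at least two, the curvature determines the 1-homogeneous form representing it:
contracting the difference `η` of two such forms with the spray first gives `η (y) = 0`, and
then `- η = 2 η`, by homogeneity. -/
theorem RepresentsCurv.unique [FiniteDimensional ℝ E] (hn : 1 < finrank ℝ E)
    (h : IsLocalSpray U S) {θ θ' : E × E → E × E →L[ℝ] ℝ}
    (hθ : IsLocalForm U θ) (hθ' : IsLocalForm U θ') (he : IsEulerForm U θ)
    (he' : IsEulerForm U θ') (hR : RepresentsCurv U S θ) (hR' : RepresentsCurv U S θ')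
    (hz : z ∈ U) : θ z = θ' z := by
  have h1 : ∀ w ∈ U, θ w (w.2, 0) = θ' w (w.2, 0) :=
    fun w hw => (eq_of_smul_sub_smul_eq hn (h.ne_zero w hw)
      fun v => (hR.curv_snd hw v).symm.trans (hR'.curv_snd hw v)).1
  have h2 : ∀ v : E, θ z (v, 0) = θ' z (v, 0) := by
    intro v
    have e1 := (eq_of_smul_sub_smul_eq hn (h.ne_zero z hz)
      fun v => (hR.curv_snd hz v).symm.trans (hR'.curv_snd hz v)).2 v
    have e2 := congrArg (fun A => A (0, v)) (fderiv_eq_of_eqOn h.isOpen h1 hz)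
    simp only [hθ.fderiv_contract hz, hθ'.fderiv_contract hz] at e2
    simp only [dj, he z hz, he' z hz] at e1
    linarith
  refine ContinuousLinearMap.ext fun X => ?_
  rw [hθ.apply_eq hz, hθ'.apply_eq hz, h2]

/-- If `Φ = ρ J - α ⊗ C` with `ρ = α (S)`, then `ξ = (α + d_J ρ) / 3` represents the curvature,
by `[J, Φ] = 3 R`. -/
theorem representsCurv_of_isotropic (h : IsLocalSpray U S) {α ξ : E × E → E × E →L[ℝ] ℝ}
    (hα : IsLocalForm U α) (hξ : IsLocalForm U ξ)
    (hiso : ∀ z ∈ U, ∀ v : E, curv S z z.2 v = α z (z.2, 0) • v - α z (v, 0) • z.2)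
    (hdef : ∀ z ∈ U, ∀ v : E,
      3 * ξ z (v, 0) = α z (v, 0) + fderiv ℝ (fun w => α w (w.2, 0)) z (0, v)) :
    RepresentsCurv U S ξ := by
  intro z hz u v
  have hρ := hα.smooth_contract
  have hd1 := hα.diffAt hz
  have key : ∀ u v : E, fderiv ℝ (fun w => curv S w w.2 v) z (0, u)
      = fderiv ℝ (fun w => α w (w.2, 0)) z (0, u) • v - fderiv ℝ α z (0, u) (v, 0) • z.2
        - α z (v, 0) • u := by
    intro u v
    have a1 := diffAt_of_smoothOn h.isOpen hρ hz
    have a2 : DifferentiableAt ℝ (fun w => α w (v, 0)) z := by fun_prop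
    rw [fderiv_eq_of_eqOn h.isOpen (fun w hw => hiso w hw v) hz,
      fderiv_fun_sub (a1.smul_const v) (a2.fun_smul differentiableAt_snd),
      fderiv_smul_const a1, fderiv_fun_smul a2 differentiableAt_snd]
    simp [fderiv_snd, fderiv_clm_apply_const hd1]
    module
  have hξ1 : ∀ u v : E, 3 * fderiv ℝ ξ z (0, u) (v, 0) = fderiv ℝ α z (0, u) (v, 0)
      + fderiv ℝ (fderiv ℝ (fun w => α w (w.2, 0))) z (0, u) (0, v) := by
    intro u v
    have b1 := diffAt_of_smoothOn h.isOpen (smoothOn_fderiv h.isOpen hρ) hz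
    have := DFunLike.congr_fun (fderiv_eq_of_eqOn h.isOpen (fun w hw => hdef w hw v) hz) (0, u)
    have b2 := hξ.diffAt hz
    rw [fderiv_const_mul (by fun_prop), fderiv_fun_add (by fun_prop) (by fun_prop),
      _root_.smul_apply, _root_.add_apply, fderiv_clm_apply_const b2,
      fderiv_clm_apply_const hd1, fderiv_clm_apply_const b1] at this
    exact this
  have hsymm := fderiv_fderiv_symm h.isOpen hρ hz (0, u) (0, v)
  have h3 := h.three_smul_curv hz u v
  rw [key, key] at h3
  -- the second derivatives of `ρ` cancel, as `d_J d_J ρ = 0`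
  have hj : 3 * dj ξ z u v = fderiv ℝ α z (0, u) (v, 0) - fderiv ℝ α z (0, v) (u, 0) := by
    have := hξ1 u v
    have := hξ1 v u
    simp only [dj]
    linarith
  have hu := hdef z hz u
  have hv := hdef z hz v
  have hinj : Function.Injective (fun e : E => (3 : ℝ) • e) := smul_right_injective E (by norm_num)
  apply hinj
  simp only [smul_sub, smul_smul, hj, hu, hv, h3]
  module

/-- The form `ξ = (α + d_J ρ) / 3` satisfies Euler's relation, by contraction of
`R = ξ ∧ J - d_J ξ ⊗ C` with the spray. -/
theorem isEulerForm_of_isotropic [FiniteDimensional ℝ E] (hn : 1 < finrank ℝ E)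
    (h : IsLocalSpray U S) {α ξ : E × E → E × E →L[ℝ] ℝ}
    (hα : IsLocalForm U α) (hξ : IsLocalForm U ξ)
    (hiso : ∀ z ∈ U, ∀ v : E, curv S z z.2 v = α z (z.2, 0) • v - α z (v, 0) • z.2)
    (hdef : ∀ z ∈ U, ∀ v : E,
      3 * ξ z (v, 0) = α z (v, 0) + fderiv ℝ (fun w => α w (w.2, 0)) z (0, v)) :
    IsEulerForm U ξ := by
  have hR := representsCurv_of_isotropic h hα hξ hiso hdef
  have h1 : ∀ w ∈ U, ξ w (w.2, 0) = α w (w.2, 0) :=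
    fun w hw => (eq_of_smul_sub_smul_eq hn (h.ne_zero w hw)
      fun v => (hR.curv_snd hw v).symm.trans (hiso w hw v)).1
  intro z hz v
  have e1 := (eq_of_smul_sub_smul_eq hn (h.ne_zero z hz)
    fun v => (hR.curv_snd hz v).symm.trans (hiso z hz v)).2 v
  have e2 := congrArg (fun A => A (0, v)) (fderiv_eq_of_eqOn h.isOpen h1 hz)
  simp only [hξ.fderiv_contract hz] at e2
  have e3 := hdef z hz v
  simp only [dj] at e1
  linarith

end Forms

/-! ### Schur's lemma in coordinates -/

section Schur

variable {E : Type*} [NormedAddCommGroup E] [NormedSpace ℝ E] {U : Set (E × E)}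
  {S : E × E → E × E} {z : E × E} {ξ : E × E → E × E →L[ℝ] ℝ}

theorem IsLocalForm.fderiv_dj (hξ : IsLocalForm U ξ) (hz : z ∈ U) (u v : E) (X : E × E) :
    fderiv ℝ (fun w => dj ξ w u v) z X
      = fderiv ℝ (fderiv ℝ ξ) z X (0, u) (v, 0) - fderiv ℝ (fderiv ℝ ξ) z X (0, v) (u, 0) := by
  have hd := hξ.diffAt_fderiv hz
  have hd' : ∀ Y, DifferentiableAt ℝ (fun w => fderiv ℝ ξ w Y) z := fun Y => by fun_prop
  unfold dj
  rw [fderiv_fun_sub (by fun_prop) (by fun_prop)]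
  simp only [_root_.sub_apply, fderiv_clm_apply_const (hd' _), fderiv_clm_apply_const hd]

theorem IsLocalForm.fderiv_dh (h : IsLocalSpray U S) (hξ : IsLocalForm U ξ) (hz : z ∈ U) (u v : E)
    (X : E × E) :
    fderiv ℝ (fun w => dh S ξ w u v) z X
      = (fderiv ℝ (fderiv ℝ ξ) z X (hor S z u) (v, 0)
          + (1 / 2 : ℝ) * fderiv ℝ ξ z (0, G2 S z X (0, u)) (v, 0))
        - (fderiv ℝ (fderiv ℝ ξ) z X (hor S z v) (u, 0)
          + (1 / 2 : ℝ) * fderiv ℝ ξ z (0, G2 S z X (0, v)) (u, 0)) := by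
  have hd := hξ.diffAt_fderiv hz
  have hh := h.diffAt_hor hz
  have key : ∀ u v : E, fderiv ℝ (fun w => fderiv ℝ ξ w (hor S w u) (v, 0)) z X
      = fderiv ℝ (fderiv ℝ ξ) z X (hor S z u) (v, 0)
          + (1 / 2 : ℝ) * fderiv ℝ ξ z (0, G2 S z X (0, u)) (v, 0) := by
    intro u v
    rw [fderiv_clm_apply_apply₂ hd (hh u) (differentiableAt_const _), h.fderiv_hor hz, vert_smul,
      map_smul]
    simp
  have hh1 := hh u
  have hh2 := hh v
  unfold dh
  rw [fderiv_fun_sub (by fun_prop) (by fun_prop), _root_.sub_apply, key, key]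

/-- Euler's relation for `d_h ξ`. -/
theorem IsEulerForm.fderiv_dh (h : IsLocalSpray U S) (hξ : IsLocalForm U ξ) (he : IsEulerForm U ξ)
    (hz : z ∈ U) (u v : E) : fderiv ℝ (fun w => dh S ξ w u v) z (0, z.2) = dh S ξ z u v := by
  have hd := hξ.diffAt hz
  have hd2 := hξ.diffAt_fderiv hz
  have e : ∀ (v : E) (X : E × E), fderiv ℝ (fderiv ℝ ξ) z X (0, z.2) (v, 0)
      + fderiv ℝ ξ z (0, X.2) (v, 0) = fderiv ℝ ξ z X (v, 0) := by
    intro v X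
    have h1 := DFunLike.congr_fun (fderiv_eq_of_eqOn h.isOpen (fun w hw => he w hw v) hz) X
    rw [fderiv_clm_apply_apply₂ (u := fun w : E × E => (0, w.2)) hd2 (by fun_prop)
      (differentiableAt_const _), fderiv_clm_apply_const hd,
      DifferentiableAt.fderiv_prodMk (by fun_prop) (by fun_prop)] at h1
    simpa [fderiv_snd] using h1
  have s1 : ∀ X, fderiv ℝ (fderiv ℝ ξ) z (0, z.2) X = fderiv ℝ (fderiv ℝ ξ) z X (0, z.2) :=
    fun X => fderiv_fderiv_symm h.isOpen hξ.smooth hz _ _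
  have s2 : ∀ u : E, G2 S z (0, z.2) (0, u) = G1 S z (0, u) := by
    intro u
    rw [h.G2_symm hz, h.G2_liouville hz]
    module
  have e1 := e v (hor S z u)
  have e2 := e u (hor S z v)
  rw [hξ.fderiv_dh h hz, s1, s1, s2, s2]
  simp only [hor, vert_smul, map_smul, _root_.smul_apply, smul_eq_mul] at e1 e2
  simp only [dh]
  simp only [hor] at *
  linarith

/-- The commutation `d_h d_J ξ = - d_J d_h ξ`, which follows from `[h, J] = 0`. -/
theorem IsLocalForm.dh_dj_add_dj_dh (h : IsLocalSpray U S) (hξ : IsLocalForm U ξ) (hz : z ∈ U)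
    (u v w : E) :
    (fderiv ℝ (fun p => dj ξ p u v) z (hor S z w) + fderiv ℝ (fun p => dj ξ p v w) z (hor S z u)
      + fderiv ℝ (fun p => dj ξ p w u) z (hor S z v))
    + (fderiv ℝ (fun p => dh S ξ p u v) z (0, w) + fderiv ℝ (fun p => dh S ξ p v w) z (0, u)
      + fderiv ℝ (fun p => dh S ξ p w u) z (0, v)) = 0 := by
  have s : ∀ X Y, fderiv ℝ (fderiv ℝ ξ) z X Y = fderiv ℝ (fderiv ℝ ξ) z Y X :=
    fun X Y => fderiv_fderiv_symm h.isOpen hξ.smooth hz _ _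
  simp only [hξ.fderiv_dj hz, hξ.fderiv_dh h hz]
  rw [s (0, w) (hor S z u), s (0, w) (hor S z v), s (0, u) (hor S z v), s (0, u) (hor S z w),
    s (0, v) (hor S z w), s (0, v) (hor S z u), h.G2_symm hz (0, w) (0, u),
    h.G2_symm hz (0, w) (0, v), h.G2_symm hz (0, u) (0, v)]
  ring

/-- The consequence `d_h ξ ∧ J = (d_h d_J ξ) ⊗ C` of the Bianchi identity `[h, R] = 0` for
`R = ξ ∧ J - d_J ξ ⊗ C`. -/
theorem RepresentsCurv.bianchi (h : IsLocalSpray U S) (hξ : IsLocalForm U ξ)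
    (hR : RepresentsCurv U S ξ) (hz : z ∈ U) (u v w : E) :
    dh S ξ z u v • w + dh S ξ z v w • u + dh S ξ z w u • v
      = (fderiv ℝ (fun p => dj ξ p u v) z (hor S z w)
          + fderiv ℝ (fun p => dj ξ p v w) z (hor S z u)
          + fderiv ℝ (fun p => dj ξ p w u) z (hor S z v)) • z.2 := by
  have hd := hξ.diffAt hz
  have hd2 := hξ.diffAt_fderiv hz
  have e : ∀ u v w : E, fderiv ℝ (fun p => curv S p u v) z (hor S z w)
        - (1 / 2 : ℝ) • G2 S z (0, w) (0, curv S z u v)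
      = fderiv ℝ ξ z (hor S z w) (u, 0) • v - fderiv ℝ ξ z (hor S z w) (v, 0) • u
        - fderiv ℝ (fun p => dj ξ p u v) z (hor S z w) • z.2
        - (1 / 2 : ℝ) • (ξ z (u, 0) • G2 S z (0, w) (0, v)
          - ξ z (v, 0) • G2 S z (0, w) (0, u)) := by
    intro u v w
    have a1 : ∀ u : E, DifferentiableAt ℝ (fun p => ξ p (u, 0)) z := fun u => by fun_prop
    have a2 : DifferentiableAt ℝ (fun p => dj ξ p u v) z := by unfold dj; fun_prop
    rw [fderiv_eq_of_eqOn h.isOpen (fun p hp => hR p hp u v) hz,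
      fderiv_fun_sub (((a1 u).smul_const v).fun_sub ((a1 v).smul_const u))
        (a2.fun_smul differentiableAt_snd),
      fderiv_fun_sub ((a1 u).smul_const v) ((a1 v).smul_const u),
      fderiv_smul_const (a1 u), fderiv_smul_const (a1 v), fderiv_fun_smul a2 differentiableAt_snd,
      hR z hz u v, vert_sub, vert_sub, vert_smul, vert_smul, vert_smul, map_sub, map_sub, map_smul,
      map_smul, map_smul, h.G2_liouville hz]
    simp only [_root_.sub_apply, _root_.add_apply, _root_.smul_apply, fderiv_snd,
      ContinuousLinearMap.smulRight_apply, fderiv_clm_apply_const hd,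
      ContinuousLinearMap.coe_snd']
    simp only [hor]
    module
  have hb := h.bianchi hz u v w
  rw [e, e, e, h.G2_symm hz (0, w) (0, v), h.G2_symm hz (0, w) (0, u),
    h.G2_symm hz (0, u) (0, v)] at hb
  rw [← sub_eq_zero, ← hb]
  simp only [dh]
  module

/-- Schur's lemma, local form: in dimension at least three, the Bianchi identity forces
`d_h ξ = 0`. It first gives `d_h ξ (y, ·) = 0`; the coefficient of `C` then reads
`d_h ξ = - 3 d_h ξ`, by homogeneity. -/
theorem RepresentsCurv.dh_eq_zero [FiniteDimensional ℝ E] (hn : 2 < finrank ℝ E)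
    (h : IsLocalSpray U S) (hξ : IsLocalForm U ξ) (he : IsEulerForm U ξ)
    (hR : RepresentsCurv U S ξ) (hz : z ∈ U) (u v : E) : dh S ξ z u v = 0 := by
  have h1 : ∀ w ∈ U, ∀ v : E, dh S ξ w w.2 v = 0 := by
    intro w hw v
    -- this is where `n > 2` enters
    obtain ⟨u, hu⟩ : ∃ u : E, u ∉ Submodule.span ℝ {v, w.2} := by
      by_contra! hc
      classical
      have h2 := (finrank_span_finset_le_card (R := ℝ) ({v, w.2} : Finset E)).trans
        Finset.card_le_two
      rw [Finset.coe_pair, Set.finrank] at h2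
      rw [(Submodule.eq_top_iff'.2 hc), finrank_top] at h2
      omega
    by_contra hne
    have hb := hR.bianchi h hξ hw u v w.2
    rw [dh_swap ξ v w.2] at hb
    refine hu (Submodule.mem_span_pair.2 ⟨(dh S ξ w w.2 v)⁻¹ * dh S ξ w w.2 u,
      (dh S ξ w w.2 v)⁻¹ * (dh S ξ w u v - (fderiv ℝ (fun p => dj ξ p u v) w (hor S w w.2)
          + fderiv ℝ (fun p => dj ξ p v w.2) w (hor S w u)
          + fderiv ℝ (fun p => dj ξ p w.2 u) w (hor S w v))), ?_⟩)
    rw [mul_smul, mul_smul, ← smul_add, inv_smul_eq_iff₀ hne, sub_smul, ← hb]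
    module
  -- the vertical derivative of `h1`; here `z.2` is held fixed, which accounts for the right side
  have h2 : ∀ u v : E, fderiv ℝ (fun p => dh S ξ p z.2 v) z (0, u) = - dh S ξ z u v := by
    intro u v
    have hd := hξ.diffAt_fderiv hz
    have hdS := h.diffAt hz
    have hh := h.diffAt_hor hz v
    have s4 : fderiv ℝ (fun w : E × E => ((w.2, 0) : E × E)) z (0, u) = (u, 0) := by
      rw [DifferentiableAt.fderiv_prodMk (by fun_prop) (by fun_prop)]
      simp [fderiv_snd]
    have e := DFunLike.congr_fun (fderiv_eq_of_eqOn (k := fun _ => (0 : ℝ)) h.isOpen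
      (f := fun w => fderiv ℝ ξ w (S w) (v, 0) - fderiv ℝ ξ w (hor S w v) (w.2, 0))
      (fun w hw => by have := h1 w hw v; rwa [dh, ← h.eq_hor hw] at this) hz) (0, u)
    rw [fderiv_fun_sub (by fun_prop) (by fun_prop), _root_.sub_apply,
      fderiv_clm_apply_apply₂ hd hdS (differentiableAt_const _),
      fderiv_clm_apply_apply₂ (v := fun w : E × E => (w.2, 0)) hd hh (by fun_prop),
      h.fderiv_hor hz, h.fderiv_eq hz, s4] at e
    have s2 : G2 S z (0, u) (0, z.2) = G1 S z (0, u) := by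
      rw [h.G2_liouville hz]
      module
    have s3 : ((u, G1 S z (0, u)) : E × E) = hor S z u + (1 / 2 : ℝ) • (0, G1 S z (0, u)) := by
      rw [hor_eq, add_assoc, ← add_smul]
      norm_num
    rw [hξ.fderiv_dh h hz, s2, ← h.eq_hor hz]
    simp only [s3, vert_smul, map_add, map_smul, _root_.add_apply, _root_.smul_apply, smul_eq_mul,
      fderiv_fun_const, Pi.zero_apply, _root_.zero_apply, map_zero, add_zero] at e
    simp only [dh]
    linarith
  -- the coefficient of `C` in the Bianchi identity, with the spray inserted
  have hb := hR.bianchi h hξ hz u v z.2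
  have hc := hξ.dh_dj_add_dj_dh h hz u v z.2
  rw [dh_swap ξ v z.2, h1 z hz, h1 z hz, neg_zero, zero_smul, zero_smul, add_zero, add_zero] at hb
  have hb' := smul_left_injective ℝ (h.ne_zero z hz) hb
  rw [← hb', he.fderiv_dh h hξ hz, h2 v u, dh_swap ξ v u] at hc
  have h3 : fderiv ℝ (fun p => dh S ξ p v z.2) z (0, u) = dh S ξ z u v := by
    have : (fun p => dh S ξ p v z.2) = fun p => - dh S ξ p z.2 v := by
      funext p
      exact dh_swap _ _ _
    rw [this, fderiv_fun_neg, _root_.neg_apply, h2, neg_neg]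
  rw [h3] at hc
  linarith

end Schur

/-! ### The energy of a Finsler metric in coordinates -/

section Energy

variable {E : Type*} [NormedAddCommGroup E] [NormedSpace ℝ E] {U : Set (E × E)}
  {S : E × E → E × E} {z : E × E} {ξ : E × E → E × E →L[ℝ] ℝ} {L : E × E → ℝ}

/-- The energy `L = F ^ 2 / 2` of a Finsler metric whose geodesic spray is `S`, on an open set. -/
structure IsLocalEnergy (U : Set (E × E)) (S : E × E → E × E) (L : E × E → ℝ) : Prop where
  spray : IsLocalSpray U S
  smooth : ContDiffOn ℝ ∞ L U
  pos : ∀ z ∈ U, 0 < L z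
  euler : ∀ z ∈ U, fderiv ℝ L z (0, z.2) = 2 * L z
  posDef : ∀ z ∈ U, ∀ u : E, u ≠ 0 → 0 < fderiv ℝ (fderiv ℝ L) z (0, u) (0, u)
  eulerLagrange : ∀ z ∈ U, ∀ X : E × E, extD (dFun vertJ L) z (S z) X = - fderiv ℝ L z X

theorem dFun_vertJ_apply (L : E × E → ℝ) (z X : E × E) :
    dFun vertJ L z X = fderiv ℝ L z (0, X.1) := by
  simp [dFun, vertJ]

theorem isLocalForm_dFun_vertJ (hU : IsOpen U) (hL : ContDiffOn ℝ ∞ L U) :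
    IsLocalForm U (dFun vertJ L) where
  isOpen := hU
  smooth := (smoothOn_fderiv hU hL).clm_comp
    (contDiffOn_const : ContDiffOn ℝ ∞ (vertJ : E × E → E × E →L[ℝ] E × E) U)
  vert z _ w := by rw [dFun_vertJ_apply, Prod.mk_zero_zero, map_zero]

namespace IsLocalEnergy

variable (h : IsLocalEnergy U S L)
include h

theorem diffAt (hz : z ∈ U) : DifferentiableAt ℝ L z :=
  diffAt_of_smoothOn h.spray.isOpen h.smooth hz

theorem diffAt_fderiv (hz : z ∈ U) : DifferentiableAt ℝ (fderiv ℝ L) z :=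
  diffAt_of_smoothOn h.spray.isOpen (smoothOn_fderiv h.spray.isOpen h.smooth) hz

theorem fderiv_symm (hz : z ∈ U) (X Y : E × E) :
    fderiv ℝ (fderiv ℝ L) z X Y = fderiv ℝ (fderiv ℝ L) z Y X :=
  fderiv_fderiv_symm h.spray.isOpen h.smooth hz X Y

theorem isLocalForm : IsLocalForm U (dFun vertJ L) :=
  isLocalForm_dFun_vertJ h.spray.isOpen h.smooth

theorem fderiv_dFun (hz : z ∈ U) (X Y : E × E) :
    fderiv ℝ (dFun vertJ L) z X Y = fderiv ℝ (fderiv ℝ L) z X (0, Y.1) := by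
  rw [← fderiv_clm_apply_const (h.isLocalForm.diffAt hz),
    ← fderiv_clm_apply_const (h.diffAt_fderiv hz)]
  simp only [dFun_vertJ_apply]

theorem fderiv_liouville (hz : z ∈ U) (X : E × E) :
    fderiv ℝ (fderiv ℝ L) z X (0, z.2) = 2 * fderiv ℝ L z X - fderiv ℝ L z (0, X.2) := by
  have h1 := DFunLike.congr_fun
    (fderiv_eq_of_eqOn h.spray.isOpen (fun w hw => h.euler w hw) hz) X
  rw [fderiv_clm_apply_apply (v := fun w : E × E => (0, w.2)) (h.diffAt_fderiv hz) (by fun_prop),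
    fderiv_const_mul (h.diffAt hz),
    DifferentiableAt.fderiv_prodMk (by fun_prop) (by fun_prop)] at h1
  simp [fderiv_snd] at h1
  linarith

/-- The horizontal part of the Euler-Lagrange equation, simplified by Euler's relation. -/
theorem fderiv_spray (hz : z ∈ U) (u : E) :
    fderiv ℝ (fderiv ℝ L) z (S z) (0, u) = fderiv ℝ L z (u, 0) := by
  have h1 := h.eulerLagrange z hz (u, 0)
  simp only [extD, h.fderiv_dFun hz, h.spray.fst_eq z hz, h.fderiv_liouville hz] at h1
  simp only [Prod.mk_zero_zero, map_zero] at h1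
  linarith

/-- `d_h d_J L = 0`, from the vertical derivative of the Euler-Lagrange equation. -/
theorem fderiv_hor_comm (hz : z ∈ U) (u v : E) :
    fderiv ℝ (fderiv ℝ L) z (hor S z u) (0, v) = fderiv ℝ (fderiv ℝ L) z (hor S z v) (0, u) := by
  have hd := h.diffAt_fderiv hz
  have hd2 := diffAt_of_smoothOn h.spray.isOpen
    (smoothOn_fderiv h.spray.isOpen (smoothOn_fderiv h.spray.isOpen h.smooth)) hz
  -- `e u v` minus `e v u` is twice the claim, since third derivatives are symmetric
  have e : ∀ u v : E, fderiv ℝ (fderiv ℝ (fderiv ℝ L)) z (S z) (0, v) (0, u)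
      + fderiv ℝ (fderiv ℝ L) z (v, 0) (0, u)
      + fderiv ℝ (fderiv ℝ L) z (0, G1 S z (0, v)) (0, u)
      = fderiv ℝ (fderiv ℝ L) z (u, 0) (0, v) := by
    intro u v
    have h1 := DFunLike.congr_fun
      (fderiv_eq_of_eqOn h.spray.isOpen (fun w hw => h.fderiv_spray hw u) hz) (0, v)
    rw [fderiv_clm_apply_apply₂ hd2 (h.spray.diffAt hz) (differentiableAt_const _),
      fderiv_clm_apply_const hd, h.spray.fderiv_eq hz,
      fderiv_fderiv_symm h.spray.isOpen (smoothOn_fderiv h.spray.isOpen h.smooth) hz (0, v),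
      h.fderiv_symm hz (0, v)] at h1
    have s : ((v, G1 S z (0, v)) : E × E) = (v, 0) + (0, G1 S z (0, v)) := by simp
    rw [← h1]
    simp only [s, map_add, _root_.add_apply, fderiv_fun_const, Pi.zero_apply, _root_.zero_apply,
      map_zero]
    ring
  have e1 := e u v
  have e2 := e v u
  rw [fderiv_fderiv_fderiv_symm h.spray.isOpen h.smooth hz] at e1
  simp only [hor_eq, map_add, map_smul, _root_.add_apply, _root_.smul_apply, smul_eq_mul]
  linarith

theorem dh_dFun (hz : z ∈ U) (u v : E) : dh S (dFun vertJ L) z u v = 0 := by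
  simp only [dh, h.fderiv_dFun hz, h.fderiv_hor_comm hz u v, sub_self]

theorem dj_dFun (hz : z ∈ U) (u v : E) : dj (dFun vertJ L) z u v = 0 := by
  simp only [dj, h.fderiv_dFun hz, h.fderiv_symm hz (0, u), sub_self]

/-- `d_h L = 0`: horizontal curves preserve the energy. -/
theorem fderiv_hor (hz : z ∈ U) (u : E) : fderiv ℝ L z (hor S z u) = 0 := by
  have h1 := h.fderiv_hor_comm hz u z.2
  rw [h.fderiv_liouville hz, ← h.spray.eq_hor hz, h.fderiv_spray hz] at h1
  simp only [hor_eq, map_add, map_smul, smul_eq_mul, Prod.snd_add, Prod.smul_snd, zero_add,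
    vert_smul] at h1 ⊢
  linarith

/-- `d_R L = 0`: the curvature preserves the energy, by commuting horizontal derivatives. -/
theorem fderiv_curv (hz : z ∈ U) (u v : E) : fderiv ℝ L z (0, curv S z u v) = 0 := by
  have e : ∀ u v : E, fderiv ℝ (fderiv ℝ L) z (hor S z v) (hor S z u)
      + (1 / 2 : ℝ) * fderiv ℝ L z (0, G2 S z (hor S z v) (0, u)) = 0 := by
    intro u v
    have h1 := DFunLike.congr_fun (fderiv_eq_of_eqOn (k := fun _ => (0 : ℝ)) h.spray.isOpen
      (fun w hw => h.fderiv_hor hw u) hz) (hor S z v)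
    rw [fderiv_clm_apply_apply (h.diffAt_fderiv hz) (h.spray.diffAt_hor hz u),
      h.spray.fderiv_hor hz, vert_smul, map_smul, smul_eq_mul] at h1
    simpa using h1
  have e1 := e u v
  have e2 := e v u
  rw [h.fderiv_symm hz] at e1
  simp only [curv, vert_sub, vert_smul, map_sub, map_smul, smul_eq_mul]
  linarith

/-- A representing form `ξ` with `d_J ξ = 0` is a multiple of `d_J L`, because `d_R L = 0`. -/
theorem eq_factor_mul (hR : RepresentsCurv U S ξ) (hj : ∀ z ∈ U, ∀ u v, dj ξ z u v = 0)
    (hz : z ∈ U) (v : E) :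
    ξ z (v, 0) = ξ z (z.2, 0) / (2 * L z) * fderiv ℝ L z (0, v) := by
  have hL0 : 2 * L z ≠ 0 := by have := h.pos z hz; positivity
  have e := h.fderiv_curv hz z.2 v
  rw [hR z hz, hj z hz, zero_smul, sub_zero, vert_sub, vert_smul, vert_smul, map_sub, map_smul,
    map_smul, h.euler z hz, smul_eq_mul, smul_eq_mul] at e
  rw [div_mul_eq_mul_div, eq_div_iff hL0]
  linarith

/-- If `d_J ξ = 0` and `d_h ξ = 0` for a representing form `ξ = k d_J L`, then `k` has zero
derivative. Here `d_J ξ = 0` makes `k` independent of `y`; then `d_h ξ = 0` reads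
`dk ∧ d_J L = 0`, whose vertical derivative contradicts the definiteness of the Hessian of `L`
unless `dk = 0`. -/
theorem fderiv_factor [FiniteDimensional ℝ E] (hn : 1 < finrank ℝ E)
    (hξ : IsLocalForm U ξ) (he : IsEulerForm U ξ) (hR : RepresentsCurv U S ξ)
    (hj : ∀ z ∈ U, ∀ u v, dj ξ z u v = 0) (hh : ∀ z ∈ U, ∀ u v, dh S ξ z u v = 0) (hz : z ∈ U) :
    fderiv ℝ (fun w => ξ w (w.2, 0) / (2 * L w)) z = 0 := by
  have hU := h.spray.isOpen
  set k : E × E → ℝ := fun w => ξ w (w.2, 0) / (2 * L w)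
  have hL0 : ∀ w ∈ U, 2 * L w ≠ 0 := fun w hw => by have := h.pos w hw; positivity
  have hks : ContDiffOn ℝ ∞ k U :=
    hξ.smooth_contract.div (contDiffOn_const.mul h.smooth) hL0
  have hkd : ∀ w ∈ U, DifferentiableAt ℝ k w := fun w => diffAt_of_smoothOn hU hks
  have hkd2 : ∀ w ∈ U, DifferentiableAt ℝ (fderiv ℝ k) w :=
    fun w => diffAt_of_smoothOn hU (smoothOn_fderiv hU hks)
  have hk2 : ∀ w ∈ U, ξ w (w.2, 0) = k w * (2 * L w) := fun w hw =>
    (div_mul_cancel₀ _ (hL0 w hw)).symm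
  have h1 : ∀ w ∈ U, ∀ v : E, ξ w (v, 0) = k w * fderiv ℝ L w (0, v) :=
    fun w hw => h.eq_factor_mul hR hj hw
  have h2 : ∀ w ∈ U, ∀ v : E, fderiv ℝ k w (0, v) = 0 := by
    intro w hw v
    have e := DFunLike.congr_fun (fderiv_eq_of_eqOn hU hk2 hw) (0, v)
    have hLd := h.diffAt hw
    rw [hξ.fderiv_contract hw, fderiv_fun_mul (hkd w hw) (by fun_prop),
      fderiv_const_mul hLd] at e
    simp only [_root_.add_apply, _root_.smul_apply, smul_eq_mul] at e
    have e1 := hj w hw v w.2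
    rw [dj, he w hw, sub_eq_zero] at e1
    rw [e1, h1 w hw v] at e
    have : (2 * L w) * fderiv ℝ k w (0, v) = 0 := by linarith
    exact (mul_eq_zero.1 this).resolve_left (hL0 w hw)
  have hsplit : ∀ w ∈ U, ∀ X : E × E, fderiv ℝ k w X = fderiv ℝ k w (X.1, 0) := by
    intro w hw X
    have : X = (X.1, 0) + (0, X.2) := by simp
    conv_lhs => rw [this, map_add, h2 w hw, add_zero]
  have h3 : ∀ w ∈ U, ∀ u v : E, fderiv ℝ k w (u, 0) * fderiv ℝ L w (0, v)
      = fderiv ℝ k w (v, 0) * fderiv ℝ L w (0, u) := by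
    intro w hw u v
    have key : ∀ (v : E) (X : E × E), fderiv ℝ ξ w X (v, 0)
        = fderiv ℝ k w X * fderiv ℝ L w (0, v)
          + k w * fderiv ℝ (fderiv ℝ L) w X (0, v) := by
      intro v X
      have hLd := h.diffAt_fderiv hw
      have e := DFunLike.congr_fun (fderiv_eq_of_eqOn hU (fun p hp => h1 p hp v) hw) X
      rw [fderiv_clm_apply_const (hξ.diffAt hw), fderiv_fun_mul (hkd w hw) (by fun_prop)] at e
      simp only [_root_.add_apply, _root_.smul_apply, smul_eq_mul,
        fderiv_clm_apply_const hLd] at e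
      linarith
    have e := hh w hw u v
    rw [dh, key, key, h.fderiv_hor_comm hw u v, hsplit w hw (hor S w u),
      hsplit w hw (hor S w v)] at e
    simp only [hor] at e
    linarith
  -- `h3` will be differentiated vertically in a direction `e` tangent to the level set of `L`
  obtain ⟨e, he0, heL⟩ : ∃ e : E, e ≠ 0 ∧ fderiv ℝ L z (0, e) = 0 := by
    have hker := LinearMap.ker_ne_bot_of_finrank_lt
      (f := ((fderiv ℝ L z).comp (ContinuousLinearMap.inr ℝ E E)).toLinearMap) (by simpa using hn)
    obtain ⟨e, he1, he2⟩ := Submodule.exists_mem_ne_zero_of_ne_bot hker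
    exact ⟨e, he2, he1⟩
  have h4 : ∀ w ∈ U, fderiv ℝ k w (e, 0) * (2 * L w)
      = fderiv ℝ k w (w.2, 0) * fderiv ℝ L w (0, e) := by
    intro w hw
    rw [← h.euler w hw, h3 w hw]
  have h5 : fderiv ℝ k z (z.2, 0) = 0 := by
    have hLd := h.diffAt hz
    have hLd2 := h.diffAt_fderiv hz
    have hkz := hkd2 z hz
    have hkv : ∀ v : E, fderiv ℝ (fderiv ℝ k) z (0, e) (v, 0) = 0 := by
      intro v
      rw [fderiv_fderiv_symm hU hks hz, ← fderiv_clm_apply_const hkz,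
        fderiv_eq_of_eqOn hU (fun w hw => h2 w hw e) hz]
      simp
    have hke : fderiv ℝ k z (e, 0) = 0 := by
      have := h4 z hz
      rw [heL, mul_zero] at this
      exact (mul_eq_zero.1 this).resolve_right (hL0 z hz)
    have hs : fderiv ℝ (fun w : E × E => ((w.2, 0) : E × E)) z (0, e) = (e, 0) := by
      rw [DifferentiableAt.fderiv_prodMk (by fun_prop) (by fun_prop)]
      simp [fderiv_snd]
    have hs' : fderiv ℝ (fun w : E × E => fderiv ℝ k w (w.2, 0)) z (0, e) = 0 := by
      rw [fderiv_clm_apply_apply (v := fun w : E × E => (w.2, 0)) hkz (by fun_prop), hs, hke, hkv,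
        add_zero]
    have e1 := DFunLike.congr_fun (fderiv_eq_of_eqOn hU h4 hz) (0, e)
    rw [fderiv_fun_mul (by fun_prop) (by fun_prop), fderiv_const_mul hLd,
      fderiv_fun_mul (by fun_prop) (by fun_prop)] at e1
    simp only [_root_.add_apply, _root_.smul_apply, smul_eq_mul, hs',
      fderiv_clm_apply_const hLd2, fderiv_clm_apply_const hkz, hkv, hke, heL] at e1
    have hp := h.posDef z hz e he0
    have : fderiv ℝ k z (z.2, 0) * fderiv ℝ (fderiv ℝ L) z (0, e) (0, e) = 0 := by linarith
    exact (mul_eq_zero.1 this).resolve_right hp.ne'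
  refine ContinuousLinearMap.ext fun X => ?_
  have e1 := h3 z hz X.1 z.2
  rw [h5, zero_mul, h.euler z hz] at e1
  rw [hsplit z hz]
  exact (mul_eq_zero.1 e1).resolve_right (hL0 z hz)

end IsLocalEnergy

end Energy

section Trace

variable {E : Type*} [NormedAddCommGroup E] [NormedSpace ℝ E] [FiniteDimensional ℝ E]

/-- The trace of `r Id - β ⊗ y` when `β y = r`. -/
theorem trace_eq_of_eq_smul_sub (T : E →ₗ[ℝ] E) (r : ℝ) (β : E →ₗ[ℝ] ℝ) (y : E)
    (hT : ∀ u, T u = r • u - β u • y) (hy : β y = r) :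
    LinearMap.trace ℝ E T = ((finrank ℝ E : ℝ) - 1) * r := by
  have : T = r • LinearMap.id - β.smulRight y := by
    ext u
    simp [hT]
  rw [this, map_sub, map_smul, LinearMap.trace_id, LinearMap.trace_smulRight, hy, smul_eq_mul]
  ring

/-- An endomorphism of a plane with kernel containing `y` and range in `ker ℓ`, where `ℓ y ≠ 0`. -/
theorem eq_trace_smul_sub (hn : finrank ℝ E = 2) (T : E →ₗ[ℝ] E) (ℓ : E →ₗ[ℝ] ℝ) (y : E)
    (hy : ℓ y ≠ 0) (hT : T y = 0) (hℓ : ∀ u, ℓ (T u) = 0) (u : E) :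
    T u = LinearMap.trace ℝ E T • u - (LinearMap.trace ℝ E T * ℓ u / ℓ y) • y := by
  have hℓ0 : ℓ ≠ 0 := fun h => hy (by simp [h])
  have hk : finrank ℝ (LinearMap.ker ℓ) = 1 := by
    have := Module.Dual.finrank_ker_add_one_of_ne_zero (f := ℓ) hℓ0
    omega
  -- `T` has rank at most one: its range lies in the line `ker ℓ`, spanned by `e`
  obtain ⟨⟨e, he⟩, he0, hspan⟩ := finrank_eq_one_iff'.1 hk
  have hspan' : ∀ v : E, ℓ v = 0 → ∃ c : ℝ, c • e = v := fun v hv => by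
    obtain ⟨c, hc⟩ := hspan ⟨v, hv⟩
    exact ⟨c, congrArg Subtype.val hc⟩
  have he0' : e ≠ 0 := fun h => he0 (Subtype.ext h)
  obtain ⟨f, hf⟩ := SeparatingDual.exists_eq_one (R := ℝ) he0'
  have hTe : ∀ u, T u = f (T u) • e := fun u => by
    obtain ⟨c, hc⟩ := hspan' (T u) (hℓ u)
    simp [← hc, hf]
  have htr : LinearMap.trace ℝ E T = f (T e) := by
    have : T = (f.toLinearMap ∘ₗ T).smulRight e := LinearMap.ext hTe
    conv_lhs => rw [this]
    rw [LinearMap.trace_smulRight]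
    rfl
  obtain ⟨t, ht⟩ := hspan' (u - (ℓ u / ℓ y) • y) (by simp [hy])
  have hu : u = (ℓ u / ℓ y) • y + t • e := by
    rw [ht]
    module
  have hTu : T u = (t * f (T e)) • e := by
    conv_lhs => rw [hu, map_add, map_smul, map_smul, hT, hTe e, smul_zero, zero_add, smul_smul]
  rw [hTu, htr]
  conv_rhs => rw [hu]
  simp only [map_add, map_smul, show ℓ e = 0 from he, smul_eq_mul, mul_zero, add_zero,
    div_mul_cancel₀ _ hy]
  module

end Trace

/-! ### The Ricci scalar and changes of coordinates -/

section Ricci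

variable {E : Type*} [NormedAddCommGroup E] [NormedSpace ℝ E] {U : Set (E × E)}
  {S : E × E → E × E} {z : E × E}

/-- The endomorphism of `E` underlying the Jacobi endomorphism. -/
def jacobiBase (S : E × E → E × E) (z : E × E) : E →L[ℝ] E :=
  (ContinuousLinearMap.snd ℝ E E).comp ((jacobiEndo S z).comp (ContinuousLinearMap.inl ℝ E E))

theorem IsLocalSpray.jacobiBase_apply (h : IsLocalSpray U S) (hz : z ∈ U) (u : E) :
    jacobiBase S z u = curv S z z.2 u := by
  simp [jacobiBase, h.jacobiEndo_apply hz]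

theorem IsLocalSpray.ricciScalar_eq [FiniteDimensional ℝ E] (hn : 1 < finrank ℝ E)
    (h : IsLocalSpray U S) (hz : z ∈ U) (r : ℝ) (β : E →ₗ[ℝ] ℝ)
    (hT : ∀ u, curv S z z.2 u = r • u - β u • z.2) (hy : β z.2 = r) :
    ricciScalar S z = r := by
  have h1 := trace_eq_of_eq_smul_sub (jacobiBase S z).toLinearMap r β z.2
    (fun u => by rw [← hT u]; exact h.jacobiBase_apply hz u) hy
  have hn' : (1 : ℝ) < finrank ℝ E := by exact_mod_cast hn
  rw [ricciScalar, div_eq_iff (by linarith), mul_comm, ← h1]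
  rfl

/-- In dimension two, `Φ y = 0` and `d_J L ∘ Φ = 0` make the geodesic spray isotropic. -/
theorem IsLocalEnergy.curv_of_finrank_eq_two [FiniteDimensional ℝ E] (hn : finrank ℝ E = 2)
    {L : E × E → ℝ} (h : IsLocalEnergy U S L) (hz : z ∈ U) (u : E) :
    curv S z z.2 u
      = ricciScalar S z • u - (ricciScalar S z * fderiv ℝ L z (0, u) / (2 * L z)) • z.2 := by
  have hL : fderiv ℝ L z (0, z.2) ≠ 0 := by
    have := h.pos z hz
    rw [h.euler z hz]
    positivity
  have h1 := eq_trace_smul_sub hn (jacobiBase S z).toLinearMap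
    ((fderiv ℝ L z).comp (ContinuousLinearMap.inr ℝ E E)).toLinearMap z.2 hL
    ((h.spray.jacobiBase_apply hz _).trans (curv_self _))
    (fun u => by
      have := h.fderiv_curv hz z.2 u
      rw [← h.spray.jacobiBase_apply hz] at this
      exact this) u
  have h2 : LinearMap.trace ℝ E (jacobiBase S z).toLinearMap = ricciScalar S z := by
    simp only [ricciScalar, semibasicTrace, hn]
    norm_num
    rfl
  have h3 : ((fderiv ℝ L z).comp (ContinuousLinearMap.inr ℝ E E)).toLinearMap z.2 = 2 * L z :=
    h.euler z hz
  rw [h2, h3] at h1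
  exact (h.spray.jacobiBase_apply hz u).symm.trans h1

theorem IsLocalSpray.smooth_ricciScalar [FiniteDimensional ℝ E] (h : IsLocalSpray U S) :
    ContDiffOn ℝ ∞ (ricciScalar S) U := by
  have hD := smoothOn_fderiv h.isOpen h.smooth
  have hJ : ContDiffOn ℝ ∞ (vertJ : E × E → E × E →L[ℝ] E × E) U := contDiffOn_const
  have hb : ∀ K : E × E → E × E →L[ℝ] E × E, ContDiffOn ℝ ∞ K U →
      ContDiffOn ℝ ∞ (vecEndoBracket S K) U := fun K hK =>
    (((smoothOn_fderiv h.isOpen hK).clm_apply h.smooth).sub (hD.clm_comp hK)).add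
      (hK.clm_comp hD)
  have hv : ContDiffOn ℝ ∞ (verProj S) U := (contDiffOn_const.add (hb _ hJ)).const_smul _
  have hΦ : ContDiffOn ℝ ∞ (jacobiEndo S) U := hv.clm_comp (hb _ h.smooth_horProj)
  let T : (E × E →L[ℝ] E × E) →ₗ[ℝ] ℝ :=
    { toFun := semibasicTrace
      map_add' := fun A B => by
        rw [semibasicTrace, semibasicTrace, semibasicTrace, ← map_add]
        congr 1
      map_smul' := fun c A => by
        rw [semibasicTrace, semibasicTrace, ← map_smul]
        rfl }
  have hT : ContDiff ℝ ∞ T := T.toContinuousLinearMap.contDiff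
  exact (hT.comp_contDiffOn hΦ).div_const _

end Ricci

section Naturality

variable {W : Type*} [NormedAddCommGroup W] [NormedSpace ℝ W]

/-- The bracket of a vector field and an endomorphism field is natural under changes of
coordinates `φ`: the second derivatives of `φ` cancel by symmetry. -/
theorem vecEndoBracket_natural {φ : W → W} {V : Set W} (hV : IsOpen V) (hφ : ContDiffOn ℝ ∞ φ V)
    {S S' : W → W} {K K' : W → W →L[ℝ] W} (hS : ∀ w ∈ V, S' (φ w) = fderiv ℝ φ w (S w))
    (hK : ∀ w ∈ V, ∀ X, K' (φ w) (fderiv ℝ φ w X) = fderiv ℝ φ w (K w X)) {z : W} (hz : z ∈ V)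
    (dS : DifferentiableAt ℝ S z) (dK : DifferentiableAt ℝ K z)
    (dS' : DifferentiableAt ℝ S' (φ z)) (dK' : DifferentiableAt ℝ K' (φ z)) (X : W) :
    vecEndoBracket S' K' (φ z) (fderiv ℝ φ z X) = fderiv ℝ φ z (vecEndoBracket S K z X) := by
  have d1 := diffAt_of_smoothOn hV hφ hz
  have d2 := diffAt_of_smoothOn hV (smoothOn_fderiv hV hφ) hz
  have hsymm := fderiv_fderiv_symm hV hφ hz
  have e1 : ∀ Y, fderiv ℝ S' (φ z) (fderiv ℝ φ z Y)
      = fderiv ℝ (fderiv ℝ φ) z Y (S z) + fderiv ℝ φ z (fderiv ℝ S z Y) := by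
    intro Y
    have := DFunLike.congr_fun (fderiv_eq_of_eqOn (f := fun w => S' (φ w)) hV hS hz) Y
    rw [fderiv_clm_apply_apply d2 dS, fderiv_fun_comp z dS' d1] at this
    exact this
  have e2 : fderiv ℝ K' (φ z) (fderiv ℝ φ z (S z)) (fderiv ℝ φ z X)
      + K' (φ z) (fderiv ℝ (fderiv ℝ φ) z (S z) X)
      = fderiv ℝ (fderiv ℝ φ) z (S z) (K z X) + fderiv ℝ φ z (fderiv ℝ K z (S z) X) := by
    have := DFunLike.congr_fun (fderiv_eq_of_eqOn (f := fun w => K' (φ w) (fderiv ℝ φ w X)) hV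
      (fun w hw => hK w hw X) hz) (S z)
    have d3 : DifferentiableAt ℝ (fun w => fderiv ℝ φ w X) z := by fun_prop
    have d4 : DifferentiableAt ℝ (fun w => K w X) z := by fun_prop
    have d5 : DifferentiableAt ℝ (fun w => K' (φ w)) z := dK'.fun_comp' z d1
    rw [fderiv_clm_apply_apply d5 d3, fderiv_clm_apply_apply d2 d4, fderiv_clm_apply_const d2,
      fderiv_clm_apply_const dK, fderiv_fun_comp z dK' d1] at this
    exact this
  simp only [vecEndoBracket, _root_.add_apply, _root_.sub_apply, ContinuousLinearMap.comp_apply,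
    map_add, map_sub, hK z hz, hS z hz, e1]
  rw [← hK z hz (fderiv ℝ S z X), ← sub_eq_zero, ← sub_eq_zero.2 e2, hsymm X (S z),
    hsymm (K z X) (S z)]
  abel

variable {E : Type*} [NormedAddCommGroup E] [NormedSpace ℝ E]

/-- A change of coordinates of the tangent bundle induced by one of the base: a smooth map with
injective derivative which commutes with the vertical endomorphism. -/
structure IsInducedChange (V V' : Set (E × E)) (φ : E × E → E × E) : Prop where
  isOpen : IsOpen V
  mapsTo : MapsTo φ V V'
  smooth : ContDiffOn ℝ ∞ φ V
  injective : ∀ z ∈ V, Function.Injective (fderiv ℝ φ z)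
  vertJ_comm : ∀ z ∈ V, ∀ X, vertJ (φ z) (fderiv ℝ φ z X) = fderiv ℝ φ z (vertJ z X)

namespace IsInducedChange

variable {V V' U : Set (E × E)} {φ S S' : E × E → E × E} {z : E × E}
  (hφ : IsInducedChange V V' φ)
include hφ

theorem jacobiEndo_natural (hVU : V ⊆ U) (h : IsLocalSpray U S) (h' : IsLocalSpray V' S')
    (hS : ∀ w ∈ V, S' (φ w) = fderiv ℝ φ w (S w)) (hz : z ∈ V) (X : E × E) :
    jacobiEndo S' (φ z) (fderiv ℝ φ z X) = fderiv ℝ φ z (jacobiEndo S z X) := by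
  have hJ : ∀ w ∈ V, ∀ X, vecEndoBracket S' vertJ (φ w) (fderiv ℝ φ w X)
      = fderiv ℝ φ w (vecEndoBracket S vertJ w X) := fun w hw X =>
    vecEndoBracket_natural hφ.isOpen hφ.smooth hS hφ.vertJ_comm hw (h.diffAt (hVU hw))
      (differentiableAt_const _) (h'.diffAt (hφ.mapsTo hw)) (differentiableAt_const _) X
  have hh : ∀ w ∈ V, ∀ X, horProj S' (φ w) (fderiv ℝ φ w X)
      = fderiv ℝ φ w (horProj S w X) := fun w hw X => by
    simp [horProj, hJ w hw]
  have hv : ∀ X, verProj S' (φ z) (fderiv ℝ φ z X) = fderiv ℝ φ z (verProj S z X) := fun X => by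
    simp [verProj, hJ z hz]
  have hb := vecEndoBracket_natural hφ.isOpen hφ.smooth hS hh hz (h.diffAt (hVU hz))
    (diffAt_of_smoothOn h.isOpen h.smooth_horProj (hVU hz)) (h'.diffAt (hφ.mapsTo hz))
    (diffAt_of_smoothOn h'.isOpen h'.smooth_horProj (hφ.mapsTo hz)) X
  simp only [jacobiEndo, ContinuousLinearMap.comp_apply, hb, hv]

theorem ricciScalar_natural [FiniteDimensional ℝ E] (hVU : V ⊆ U) (h : IsLocalSpray U S)
    (h' : IsLocalSpray V' S') (hS : ∀ w ∈ V, S' (φ w) = fderiv ℝ φ w (S w)) (hz : z ∈ V) :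
    ricciScalar S' (φ z) = ricciScalar S z := by
  -- the derivative `B` of the base change conjugates the two endomorphisms
  let B : E →ₗ[ℝ] E := (LinearMap.fst ℝ E E ∘ₗ (fderiv ℝ φ z).toLinearMap) ∘ₗ LinearMap.inl ℝ E E
  have hB : ∀ u, fderiv ℝ φ z (0, u) = (0, B u) := fun u =>
    (hφ.vertJ_comm z hz (u, 0)).symm
  have hBi : Function.Injective B := fun u v huv => by
    have := hφ.injective z hz ((hB u).trans ((congrArg _ huv).trans (hB v).symm))
    exact (Prod.mk.inj this).2
  let e : E ≃ₗ[ℝ] E := LinearEquiv.ofInjectiveEndo B hBi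
  have hconj : (jacobiBase S' (φ z)).toLinearMap = e.conj (jacobiBase S z).toLinearMap := by
    refine LinearMap.ext fun v => ?_
    obtain ⟨u, rfl⟩ := e.surjective v
    have h1 := hφ.jacobiEndo_natural hVU h h' hS hz (u, 0)
    rw [h.jacobiEndo_apply (hVU hz), h'.jacobiEndo_apply (hφ.mapsTo hz), hB,
      ← h.jacobiBase_apply (hVU hz), ← h'.jacobiBase_apply (hφ.mapsTo hz)] at h1
    rw [LinearEquiv.conj_apply_apply, e.symm_apply_apply]
    exact (Prod.mk.inj h1).2
  have : LinearMap.trace ℝ E (jacobiBase S' (φ z)).toLinearMap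
      = LinearMap.trace ℝ E (jacobiBase S z).toLinearMap := by
    rw [hconj, LinearMap.trace_conj']
  exact congrArg (· / ((finrank ℝ E : ℝ) - 1)) this

/-- The form `d_J f` does not depend on the coordinates. -/
theorem dFun_vertJ_natural {f f' : E × E → ℝ} (hf : ∀ w ∈ V, f' (φ w) = f w) (hz : z ∈ V)
    (hd : DifferentiableAt ℝ f' (φ z)) (X : E × E) :
    dFun vertJ f' (φ z) (fderiv ℝ φ z X) = dFun vertJ f z X := by
  have e : fderiv ℝ f' (φ z) ∘L fderiv ℝ φ z = fderiv ℝ f z := by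
    rw [← fderiv_comp z hd (diffAt_of_smoothOn hφ.isOpen hφ.smooth hz)]
    exact fderiv_eq_of_eqOn hφ.isOpen hf hz
  simp only [dFun, ContinuousLinearMap.comp_apply, hφ.vertJ_comm z hz, ← e]

end IsInducedChange

end Naturality

/-! ### The induced charts of the tangent bundle -/

section Charts

variable {E : Type*} [NormedAddCommGroup E] [NormedSpace ℝ E]
  {M : Type*} [TopologicalSpace M] [ChartedSpace E M] [IsManifold 𝓘(ℝ, E) ∞ M]

theorem tChart_target (a : M) :
    (tChart E a).target = (extChartAt 𝓘(ℝ, E) a).target ×ˢ univ := by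
  rw [tChart, FiberBundle.extChartAt_target]
  congr 1
  refine inter_eq_left.2 fun x hx => ?_
  simpa using (extChartAt 𝓘(ℝ, E) a).map_target hx

theorem tChart_source (a : M) :
    (tChart E a).source = {p : TangentBundle 𝓘(ℝ, E) M | p.1 ∈ (extChartAt 𝓘(ℝ, E) a).source} := by
  ext p
  rw [tChart, extChartAt_source, extChartAt_source]
  exact TangentBundle.mem_chart_source_iff p ⟨a, 0⟩

theorem tChart_apply (a : M) (p : TangentBundle 𝓘(ℝ, E) M) :
    tChart E a p = (extChartAt 𝓘(ℝ, E) a p.1, tangentCoordChange 𝓘(ℝ, E) p.1 a p.1 p.2) := by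
  rw [tChart, FiberBundle.extChartAt]
  rfl

theorem tChart_symm_fst (a : M) (z : E × E) :
    ((tChart E a).symm z).1 = (extChartAt 𝓘(ℝ, E) a).symm z.1 := by
  rw [tChart, FiberBundle.extChartAt]
  rfl

theorem tChart_range : range (𝓘(ℝ, E).tangent) = univ := ModelWithCorners.range_eq_univ _

theorem slitTarget_eq (a : M) :
    slitTarget E a = (extChartAt 𝓘(ℝ, E) a).target ×ˢ {y | y ≠ 0} := by
  ext z
  simp [slitTarget, tChart_target]

theorem isOpen_slitTarget (a : M) : IsOpen (slitTarget E a) := by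
  rw [slitTarget_eq]
  exact (isOpen_extChartAt_target a).prod isOpen_ne

theorem smul_mem_slitTarget {a : M} {z : E × E} (hz : z ∈ slitTarget E a) {t : ℝ} (ht : 0 < t) :
    (z.1, t • z.2) ∈ slitTarget E a := by
  rw [slitTarget_eq] at hz ⊢
  exact ⟨hz.1, smul_ne_zero ht.ne' hz.2⟩

/-- A tangent vector is zero exactly when its coordinates in an induced chart are. -/
theorem tChart_snd_eq_zero_iff {a : M} {p : TangentBundle 𝓘(ℝ, E) M}
    (hp : p ∈ (tChart E a).source) : (tChart E a p).2 = 0 ↔ p.2 = 0 := by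
  rw [tChart_apply]
  rw [tChart_source] at hp
  have hp' : p.1 ∈ (extChartAt 𝓘(ℝ, E) a).source := hp
  refine ⟨fun h => ?_, fun h => ?_⟩
  · have h1 := tangentCoordChange_comp (I := 𝓘(ℝ, E)) (w := p.1) (x := a) (y := p.1) (z := p.1)
      (v := p.2) ⟨⟨mem_extChartAt_source p.1, hp'⟩, mem_extChartAt_source p.1⟩
    have h2 : tangentCoordChange 𝓘(ℝ, E) p.1 a p.1 p.2 = 0 := h
    rw [h2, map_zero] at h1
    exact (h1.trans (tangentCoordChange_self (mem_extChartAt_source p.1))).symm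
  · exact (congrArg (tangentCoordChange 𝓘(ℝ, E) p.1 a p.1) h).trans
      (map_zero (tangentCoordChange 𝓘(ℝ, E) p.1 a p.1))

theorem tChart_symm_mem_slit {a : M} {z : E × E} (hz : z ∈ slitTarget E a) :
    (tChart E a).symm z ∈ slit E M := by
  intro h
  have h1 := (tChart_snd_eq_zero_iff ((tChart E a).map_target hz.1)).2 h
  rw [(tChart E a).right_inv hz.1] at h1
  exact hz.2 h1

theorem tChart_mem_slitTarget {a : M} {p : TangentBundle 𝓘(ℝ, E) M}
    (hp : p ∈ (tChart E a).source) (h : p ∈ slit E M) : tChart E a p ∈ slitTarget E a :=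
  ⟨(tChart E a).map_source hp, fun h0 => h ((tChart_snd_eq_zero_iff hp).1 h0)⟩

theorem mem_tChart_source_self (p : TangentBundle 𝓘(ℝ, E) M) : p ∈ (tChart E p.1).source := by
  rw [tChart_source]
  exact mem_extChartAt_source p.1

theorem tChart_symm_smul {a : M} {z : E × E} (hz : z ∈ (tChart E a).target) (t : ℝ) :
    (tChart E a).symm (z.1, t • z.2)
      = ⟨((tChart E a).symm z).1, t • ((tChart E a).symm z).2⟩ := by
  have hp := (tChart E a).map_target hz
  have h1 := (tChart E a).right_inv hz
  generalize (tChart E a).symm z = p at hp h1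
  have hq : (⟨p.1, t • p.2⟩ : TangentBundle 𝓘(ℝ, E) M) ∈ (tChart E a).source := by
    rw [tChart_source] at hp ⊢
    exact hp
  rw [← (tChart E a).left_inv hq, ← h1, tChart_apply, tChart_apply]
  congr 2
  exact (map_smul (tangentCoordChange 𝓘(ℝ, E) p.1 a p.1) t p.2).symm

/-! ### Changes of induced charts -/

variable (E) in
/-- The change of induced charts of `TM` from the one at `a` to the one at `b`. -/
def tChange (a b : M) (z : E × E) : E × E := tChart E b ((tChart E a).symm z)

variable (E) in
/-- The domain of the change of induced charts, without the zero section. -/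
def overlap (a b : M) : Set (E × E) :=
  {z | z ∈ slitTarget E a ∧ (tChart E a).symm z ∈ (tChart E b).source}

variable (E) in
/-- The change of charts of `M` from the chart at `a` to the one at `b`. -/
def baseChange (a b : M) : E → E := extChartAt 𝓘(ℝ, E) b ∘ (extChartAt 𝓘(ℝ, E) a).symm

theorem overlap_eq (a b : M) :
    overlap E a b = ((extChartAt 𝓘(ℝ, E) a).symm ≫ extChartAt 𝓘(ℝ, E) b).source ×ˢ {y | y ≠ 0} := by
  ext z
  simp only [overlap, slitTarget_eq, mem_ofPred_eq, mem_prod, PartialEquiv.trans_source,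
    PartialEquiv.symm_source, mem_inter_iff, mem_preimage, tChart_source, tChart_symm_fst]
  tauto

omit [IsManifold 𝓘(ℝ, E) ∞ M] in
theorem isOpen_baseOverlap (a b : M) :
    IsOpen ((extChartAt 𝓘(ℝ, E) a).symm ≫ extChartAt 𝓘(ℝ, E) b).source := by
  rw [PartialEquiv.trans_source]
  exact (continuousOn_extChartAt_symm a).isOpen_inter_preimage (isOpen_extChartAt_target a)
    (isOpen_extChartAt_source b)

theorem smooth_baseChange (a b : M) : ContDiffOn ℝ ∞ (baseChange E a b)
    ((extChartAt 𝓘(ℝ, E) a).symm ≫ extChartAt 𝓘(ℝ, E) b).source :=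
  contDiffOn_ext_coord_change b a

theorem isOpen_overlap (a b : M) : IsOpen (overlap E a b) := by
  rw [overlap_eq]
  exact (isOpen_baseOverlap a b).prod isOpen_ne

/-- A change of induced charts is the tangent map of a change of charts of `M`. -/
theorem tChange_eq {a b : M} {z : E × E} (hz : z ∈ overlap E a b) :
    tChange E a b z = (baseChange E a b z.1, fderiv ℝ (baseChange E a b) z.1 z.2) := by
  obtain ⟨hz1, hzb⟩ := hz
  have hza := (tChart E a).map_target hz1.1
  have h1 := (tChart E a).right_inv hz1.1
  rw [tChange, baseChange, Function.comp_apply, ← tChart_symm_fst]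
  generalize (tChart E a).symm z = p at *
  rw [tChart_source] at hza hzb
  rw [← h1, tChart_apply, tChart_apply]
  congr 1
  rw [← tangentCoordChange_comp (I := 𝓘(ℝ, E)) (w := p.1) (x := a) (y := b) (z := p.1) (v := p.2)
    ⟨⟨mem_extChartAt_source p.1, hza⟩, hzb⟩, tangentCoordChange_def (x := a)]
  simp only [modelWithCornersSelf_coe, range_id, fderivWithin_univ]

theorem smooth_tChange (a b : M) : ContDiffOn ℝ ∞ (tChange E a b) (overlap E a b) := by
  have h1 := smooth_baseChange (E := E) a b
  have h2 := smoothOn_fderiv (isOpen_baseOverlap a b) h1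
  have hm : MapsTo Prod.fst (overlap E a b)
      ((extChartAt 𝓘(ℝ, E) a).symm ≫ extChartAt 𝓘(ℝ, E) b).source := fun z hz => by
    rw [overlap_eq] at hz
    exact hz.1
  refine ContDiffOn.congr ?_ fun z hz => tChange_eq hz
  exact (h1.comp contDiffOn_fst hm).prodMk ((h2.comp contDiffOn_fst hm).clm_apply contDiffOn_snd)

theorem tChange_mapsTo (a b : M) : MapsTo (tChange E a b) (overlap E a b) (slitTarget E b) :=
  fun _ hz => tChart_mem_slitTarget hz.2 (tChart_symm_mem_slit hz.1)

theorem tChange_mem_overlap {a b : M} {z : E × E} (hz : z ∈ overlap E a b) :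
    tChange E a b z ∈ overlap E b a := by
  refine ⟨tChange_mapsTo a b hz, ?_⟩
  rw [tChange, (tChart E b).left_inv hz.2]
  exact (tChart E a).map_target hz.1.1

theorem tChange_tChange {a b : M} {z : E × E} (hz : z ∈ overlap E a b) :
    tChange E b a (tChange E a b z) = z := by
  rw [tChange, tChange, (tChart E b).left_inv hz.2, (tChart E a).right_inv hz.1.1]

theorem isInducedChange (a b : M) :
    IsInducedChange (overlap E a b) (slitTarget E b) (tChange E a b) where
  isOpen := isOpen_overlap a b
  mapsTo := tChange_mapsTo a b
  smooth := smooth_tChange a b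
  injective z hz := by
    have d1 := diffAt_of_smoothOn (isOpen_overlap a b) (smooth_tChange a b) hz
    have d2 := diffAt_of_smoothOn (isOpen_overlap b a) (smooth_tChange b a)
      (tChange_mem_overlap hz)
    have e := fderiv_eq_of_eqOn (isOpen_overlap a b) (k := fun w => w)
      (fun w hw => tChange_tChange hw) hz
    rw [fderiv_fun_comp z d2 d1, fderiv_fun_id] at e
    exact Function.LeftInverse.injective (fun X => DFunLike.congr_fun e X)
  vertJ_comm z hz X := by
    have hz1 : z.1 ∈ ((extChartAt 𝓘(ℝ, E) a).symm ≫ extChartAt 𝓘(ℝ, E) b).source := by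
      rw [overlap_eq] at hz
      exact hz.1
    have d1 := diffAt_of_smoothOn (isOpen_baseOverlap a b) (smooth_baseChange a b) hz1
    have d2 := diffAt_of_smoothOn (isOpen_baseOverlap a b)
      (smoothOn_fderiv (isOpen_baseOverlap a b) (smooth_baseChange a b)) hz1
    have d3 : DifferentiableAt ℝ (fun w : E × E => baseChange E a b w.1) z :=
      d1.fun_comp' z differentiableAt_fst
    have d4 : DifferentiableAt ℝ (fun w : E × E => fderiv ℝ (baseChange E a b) w.1) z :=
      d2.fun_comp' z differentiableAt_fst
    have e : ∀ X : E × E, fderiv ℝ (tChange E a b) z X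
        = (fderiv ℝ (baseChange E a b) z.1 X.1,
          fderiv ℝ (fderiv ℝ (baseChange E a b)) z.1 X.1 z.2
            + fderiv ℝ (baseChange E a b) z.1 X.2) := by
      intro X
      rw [fderiv_eq_of_eqOn (isOpen_overlap a b) (fun w hw => tChange_eq hw) hz,
        DifferentiableAt.fderiv_prodMk d3 (d4.clm_apply differentiableAt_snd),
        ContinuousLinearMap.prod_apply, fderiv_clm_apply d4 differentiableAt_snd,
        fderiv_fun_comp z d1 differentiableAt_fst, fderiv_fun_comp z d2 differentiableAt_fst]
      simp [fderiv_fst, fderiv_snd, add_comm]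
    simp [e, vertJ]

/-! ### Vector fields and forms in induced charts -/

theorem mdiff_tChart {a : M} {p : TangentBundle 𝓘(ℝ, E) M} (hp : p ∈ (tChart E a).source) :
    MDifferentiableAt 𝓘(ℝ, E).tangent 𝓘(ℝ, E × E) (tChart E a) p := by
  rw [tChart, extChartAt_source] at hp
  exact mdifferentiableAt_extChartAt hp

theorem mfderiv_tChart_change {a b : M} {p : TangentBundle 𝓘(ℝ, E) M} (hp : p ∈ slit E M)
    (ha : p ∈ (tChart E a).source) (hb : p ∈ (tChart E b).source)
    (v : TangentSpace 𝓘(ℝ, E).tangent p) :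
    (mfderiv 𝓘(ℝ, E).tangent 𝓘(ℝ, E × E) (tChart E b) p v : E × E)
      = fderiv ℝ (tChange E a b) (tChart E a p)
        (mfderiv 𝓘(ℝ, E).tangent 𝓘(ℝ, E × E) (tChart E a) p v : E × E) := by
  have hz : tChart E a p ∈ overlap E a b := ⟨tChart_mem_slitTarget ha hp, by
    rwa [(tChart E a).left_inv ha]⟩
  have d1 := diffAt_of_smoothOn (isOpen_overlap a b) (smooth_tChange a b) hz
  have e : tChart E b =ᶠ[nhds p] tChange E a b ∘ tChart E a := by
    have : (tChart E a).source ∈ nhds p := by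
      rw [tChart] at ha ⊢
      exact (isOpen_extChartAt_source _).mem_nhds ha
    filter_upwards [this] with q hq
    rw [Function.comp_apply, tChange, (tChart E a).left_inv hq]
  rw [e.mfderiv_eq, mfderiv_comp p d1.mdifferentiableAt (mdiff_tChart ha), mfderiv_eq_fderiv]
  rfl

theorem mfderiv_tChart_symm {a : M} {z : E × E} (hz : z ∈ (tChart E a).target) (v : E × E) :
    (mfderiv 𝓘(ℝ, E).tangent 𝓘(ℝ, E × E) (tChart E a) ((tChart E a).symm z)
      (mfderiv 𝓘(ℝ, E × E) 𝓘(ℝ, E).tangent (tChart E a).symm z v) : E × E) = v := by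
  have h := mfderiv_extChartAt_comp_mfderivWithin_extChartAt_symm (I := 𝓘(ℝ, E).tangent)
    (x := (⟨a, 0⟩ : TangentBundle 𝓘(ℝ, E) M)) (y := z) hz
  rw [tChart_range, mfderivWithin_univ] at h
  exact DFunLike.congr_fun h v

theorem mfderiv_tChart_symm' {a : M} {p : TangentBundle 𝓘(ℝ, E) M} (hp : p ∈ (tChart E a).source)
    (v : TangentSpace 𝓘(ℝ, E).tangent p) :
    mfderiv 𝓘(ℝ, E × E) 𝓘(ℝ, E).tangent (tChart E a).symm (tChart E a p)
      (mfderiv 𝓘(ℝ, E).tangent 𝓘(ℝ, E × E) (tChart E a) p v) = v := by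
  have h := mfderivWithin_extChartAt_symm_comp_mfderiv_extChartAt' (I := 𝓘(ℝ, E).tangent)
    (x := (⟨a, 0⟩ : TangentBundle 𝓘(ℝ, E) M)) hp
  rw [tChart_range, mfderivWithin_univ] at h
  exact DFunLike.congr_fun h v

theorem locVec_tChart (S : VecField E M) {a : M} {p : TangentBundle 𝓘(ℝ, E) M}
    (hp : p ∈ (tChart E a).source) :
    locVec S a (tChart E a p) = mfderiv 𝓘(ℝ, E).tangent 𝓘(ℝ, E × E) (tChart E a) p (S p) := by
  have : ∀ q, q = p → (mfderiv 𝓘(ℝ, E).tangent 𝓘(ℝ, E × E) (tChart E a) q (S q) : E × E)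
      = (mfderiv 𝓘(ℝ, E).tangent 𝓘(ℝ, E × E) (tChart E a) p (S p) : E × E) := by
    rintro q rfl
    rfl
  exact this _ ((tChart E a).left_inv hp)

theorem locVec_change (S : VecField E M) {a b : M} {z : E × E} (hz : z ∈ overlap E a b) :
    locVec S b (tChange E a b z) = fderiv ℝ (tChange E a b) z (locVec S a z) := by
  rw [tChange, locVec_tChart S hz.2, mfderiv_tChart_change (tChart_symm_mem_slit hz.1)
    ((tChart E a).map_target hz.1.1) hz.2, (tChart E a).right_inv hz.1.1]
  rfl

theorem locForm_tChart (θ : OneForm E M) {a : M} {p : TangentBundle 𝓘(ℝ, E) M}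
    (hp : p ∈ (tChart E a).source) (v : TangentSpace 𝓘(ℝ, E).tangent p) :
    locForm θ a (tChart E a p) (mfderiv 𝓘(ℝ, E).tangent 𝓘(ℝ, E × E) (tChart E a) p v)
      = θ p v := by
  have : ∀ q, q = p → (θ q : E × E →L[ℝ] ℝ) = (θ p : E × E →L[ℝ] ℝ) := by
    rintro q rfl
    rfl
  have h1 := DFunLike.congr_fun (this ((tChart E a).symm (tChart E a p)) ((tChart E a).left_inv hp))
    (mfderiv 𝓘(ℝ, E × E) 𝓘(ℝ, E).tangent (tChart E a).symm (tChart E a p)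
      (mfderiv 𝓘(ℝ, E).tangent 𝓘(ℝ, E × E) (tChart E a) p v))
  exact h1.trans (congrArg (θ p) (mfderiv_tChart_symm' hp v))

/-- 1-forms which agree in an induced chart agree. -/
theorem oneForm_eq_of_locForm_eq {θ θ' : OneForm E M} {a : M} {p : TangentBundle 𝓘(ℝ, E) M}
    (hp : p ∈ (tChart E a).source)
    (h : locForm θ a (tChart E a p) = locForm θ' a (tChart E a p)) : θ p = θ' p := by
  refine ContinuousLinearMap.ext fun v => ?_
  rw [← locForm_tChart θ hp, ← locForm_tChart θ' hp, h]

theorem locForm_change (θ : OneForm E M) {a b : M} {z : E × E} (hz : z ∈ overlap E a b)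
    (X : E × E) :
    locForm θ b (tChange E a b z) (fderiv ℝ (tChange E a b) z X) = locForm θ a z X := by
  have h1 := mfderiv_tChart_change (tChart_symm_mem_slit hz.1)
    ((tChart E a).map_target hz.1.1) hz.2
    (mfderiv 𝓘(ℝ, E × E) 𝓘(ℝ, E).tangent (tChart E a).symm z X)
  rw [mfderiv_tChart_symm hz.1.1, (tChart E a).right_inv hz.1.1] at h1
  rw [tChange, ← h1, locForm_tChart θ hz.2]
  rfl

/-- The 1-form on `TM` with prescribed expressions in the induced charts: at `p`, the expression in
the chart at the base point of `p` is used. For compatible expressions, see `locForm_glue`. -/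
def glue (θ : M → E × E → E × E →L[ℝ] ℝ) : OneForm E M := fun p =>
  (θ p.1 (tChart E p.1 p)).comp (mfderiv 𝓘(ℝ, E).tangent 𝓘(ℝ, E × E) (tChart E p.1) p)

theorem locForm_glue {θ : M → E × E → E × E →L[ℝ] ℝ}
    (h : ∀ a b : M, ∀ z ∈ overlap E a b, ∀ X,
      θ b (tChange E a b z) (fderiv ℝ (tChange E a b) z X) = θ a z X)
    {a : M} {z : E × E} (hz : z ∈ slitTarget E a) : locForm (glue θ) a z = θ a z := by
  refine ContinuousLinearMap.ext fun X => ?_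
  have hs := mem_tChart_source_self ((tChart E a).symm z)
  have h1 := mfderiv_tChart_change (tChart_symm_mem_slit hz) ((tChart E a).map_target hz.1) hs
    (mfderiv 𝓘(ℝ, E × E) 𝓘(ℝ, E).tangent (tChart E a).symm z X)
  rw [mfderiv_tChart_symm hz.1, (tChart E a).right_inv hz.1] at h1
  rw [← h a _ z ⟨hz, hs⟩ X, ← h1]
  rfl

/-- The expression of a vector field in an induced chart is its expression in a trivialization of
the second tangent bundle. -/
theorem locVec_smooth {S : VecField E M} (hS : IsSpray S) (a : M) :
    ContDiffOn ℝ ∞ (locVec S a) (slitTarget E a) := by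
  have hsrc : (tChart E a).source
      = (chartAt (ModelProd E E) (⟨a, 0⟩ : TangentBundle 𝓘(ℝ, E) M)).source :=
    extChartAt_source (I := 𝓘(ℝ, E).tangent) _
  have hO : IsOpen ((tChart E a).source ∩ tChart E a ⁻¹' slitTarget E a) :=
    (continuousOn_extChartAt _).isOpen_inter_preimage (isOpen_extChartAt_source _)
      (isOpen_slitTarget a)
  have h1 := hS.smooth.mono (t := (tChart E a).source ∩ tChart E a ⁻¹' slitTarget E a)
    fun p hp => by
      have := tChart_symm_mem_slit hp.2
      rwa [(tChart E a).left_inv hp.1] at this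
  have h2 := (Bundle.Trivialization.contMDiffOn_section_iff
    (trivializationAt (E × E) (TangentSpace 𝓘(ℝ, E).tangent)
      (⟨a, 0⟩ : TangentBundle 𝓘(ℝ, E) M)) hO
    (fun p hp => by
      rw [TangentBundle.trivializationAt_baseSet, ← hsrc]
      exact hp.1)).1 h1
  rw [← contMDiffOn_iff_contDiffOn]
  have h3 := h2.comp (s := slitTarget E a) (f := (tChart E a).symm)
    ((contMDiffOn_extChartAt_symm (I := 𝓘(ℝ, E).tangent) (n := ∞)
      (⟨a, 0⟩ : TangentBundle 𝓘(ℝ, E) M)).mono fun z hz => hz.1)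
    fun z hz => ⟨(tChart E a).map_target hz.1, by
      rw [mem_preimage, (tChart E a).right_inv hz.1]
      exact hz⟩
  refine h3.congr fun z hz => ?_
  have hp : (tChart E a).symm z ∈ (chartAt (ModelProd E E)
      (⟨a, 0⟩ : TangentBundle 𝓘(ℝ, E) M)).source := by
    rw [← hsrc]
    exact (tChart E a).map_target hz.1
  have h4 := TangentBundle.continuousLinearMapAt_trivializationAt (I := 𝓘(ℝ, E).tangent) hp
  have h5 := DFunLike.congr_fun h4 (S ((tChart E a).symm z))
  refine h5.symm.trans ?_
  rw [Bundle.Trivialization.continuousLinearMapAt_apply_of_mem]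
  · rfl
  · exact hp

theorem locFun_smooth {F : TangentBundle 𝓘(ℝ, E) M → ℝ} (hF : IsFinslerMetric F) (a : M) :
    ContDiffOn ℝ ∞ (locFun F a) (slitTarget E a) := by
  rw [← contMDiffOn_iff_contDiffOn]
  refine hF.smooth.comp ?_ fun z hz => tChart_symm_mem_slit hz
  exact (contMDiffOn_extChartAt_symm (I := 𝓘(ℝ, E).tangent) (n := ∞)
    (⟨a, 0⟩ : TangentBundle 𝓘(ℝ, E) M)).mono fun z hz => hz.1

theorem locFun_change (F : TangentBundle 𝓘(ℝ, E) M → ℝ) {a b : M} {z : E × E}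
    (hz : z ∈ overlap E a b) : locFun F b (tChange E a b z) = locFun F a z := by
  rw [locFun, tChange, (tChart E b).left_inv hz.2]
  rfl

end Charts

/-! ### From the tangent bundle to induced charts and back -/

section Bridge

variable {E : Type*} [NormedAddCommGroup E] [NormedSpace ℝ E]
  {M : Type*} [TopologicalSpace M] [ChartedSpace E M] [IsManifold 𝓘(ℝ, E) ∞ M]
  {S : VecField E M} {F : TangentBundle 𝓘(ℝ, E) M → ℝ}

theorem IsSpray.isLocalSpray (hS : IsSpray S) (a : M) :
    IsLocalSpray (slitTarget E a) (locVec S a) where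
  isOpen := isOpen_slitTarget a
  ne_zero _ hz := hz.2
  smooth := locVec_smooth hS a
  fst_eq z hz := congrArg Prod.snd (hS.vert a z hz)
  euler z hz := by
    have hd := diffAt_of_smoothOn (isOpen_slitTarget a) (locVec_smooth hS a) hz
    have h1 := congrArg Prod.snd (hS.homogeneous a z hz)
    have h2 : fderiv ℝ (liouville : E × E → E × E) z (locVec S a z) = (0, (locVec S a z).2) := by
      unfold liouville
      rw [DifferentiableAt.fderiv_prodMk (by fun_prop) (by fun_prop)]
      simp [fderiv_snd]
    rw [lieBracket, h2, Prod.snd_sub, sub_eq_iff_eq_add, ← two_smul ℝ] at h1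
    rw [← h1, fderiv.snd hd]
    rfl

/-- The Euler relation for a function which is positively homogeneous of degree `k` in `y`. -/
theorem fderiv_of_homogeneous {f : E × E → ℝ} {z : E × E} (hd : DifferentiableAt ℝ f z) (k : ℕ)
    (h : ∀ t : ℝ, 0 < t → f (z.1, t • z.2) = t ^ k * f z) :
    fderiv ℝ f z (0, z.2) = k * f z := by
  have h0 : HasDerivAt (fun t : ℝ => ((z.1, t • z.2) : E × E)) (0, z.2) 1 := by
    have := (hasDerivAt_const (1 : ℝ) z.1).prodMk ((hasDerivAt_id (1 : ℝ)).smul_const z.2)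
    simpa using this
  have h1 : HasDerivAt (fun t : ℝ => f (z.1, t • z.2)) (fderiv ℝ f z (0, z.2)) 1 := by
    have hd' : HasFDerivAt f (fderiv ℝ f z) (z.1, (1 : ℝ) • z.2) := by
      simpa using hd.hasFDerivAt
    exact hd'.comp_hasDerivAt (1 : ℝ) h0
  have h2 : HasDerivAt (fun t : ℝ => t ^ k * f z) (k * f z) 1 := by
    simpa using (hasDerivAt_pow k (1 : ℝ)).mul_const (f z)
  refine h1.unique (h2.congr_of_eventuallyEq ?_)
  filter_upwards [lt_mem_nhds one_pos] with t ht using h t ht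

/-- Conversely, Euler's relation of degree one along a ray implies homogeneity. -/
theorem homogeneous_of_fderiv {f : E × E → ℝ} {z : E × E}
    (hd : ∀ t : ℝ, 0 < t → DifferentiableAt ℝ f (z.1, t • z.2))
    (h : ∀ t : ℝ, 0 < t → fderiv ℝ f (z.1, t • z.2) (0, t • z.2) = f (z.1, t • z.2))
    {t : ℝ} (ht : 0 < t) : f (z.1, t • z.2) = t * f z := by
  have h1 : ∀ s : ℝ, 0 < s → HasDerivAt (fun s : ℝ => f (z.1, s • z.2) / s) 0 s := by
    intro s hs
    have h0 : HasDerivAt (fun t : ℝ => ((z.1, t • z.2) : E × E)) (0, z.2) s := by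
      have := (hasDerivAt_const s z.1).prodMk ((hasDerivAt_id s).smul_const z.2)
      simpa using this
    have h2 := ((hd s hs).hasFDerivAt.comp_hasDerivAt s h0).div (hasDerivAt_id s) hs.ne'
    have h3 := h s hs
    rw [vert_smul, map_smul, smul_eq_mul] at h3
    have h4 : (fderiv ℝ f (z.1, s • z.2) (0, z.2) * s - f (z.1, s • z.2) * 1) / s ^ 2 = 0 := by
      rw [mul_comm, h3, mul_one, sub_self, zero_div]
    exact h4 ▸ h2
  have h2 := isOpen_Ioi.is_const_of_deriv_eq_zero (isPreconnected_Ioi (a := (0 : ℝ)))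
    (fun s hs => (h1 s hs).differentiableAt.differentiableWithinAt)
    (fun s hs => (h1 s hs).deriv) (mem_Ioi.2 ht) (mem_Ioi.2 one_pos)
  simp only [one_smul, div_one] at h2
  rw [div_eq_iff ht.ne'] at h2
  rw [h2, mul_comm]

theorem fderiv_energy {f : E × E → ℝ} {z : E × E} (hd : DifferentiableAt ℝ f z) (X : E × E) :
    fderiv ℝ (fun w => f w ^ 2 / 2) z X = f z * fderiv ℝ f z X := by
  have h := (hd.hasFDerivAt.pow 2).mul_const (2 : ℝ)⁻¹
  simp only [div_eq_mul_inv]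
  rw [h.fderiv]
  simp
  ring

theorem IsFinslerMetric.locFun_homogeneous (hF : IsFinslerMetric F) {a : M} {z : E × E}
    (hz : z ∈ slitTarget E a) {t : ℝ} (ht : 0 < t) :
    locFun F a (z.1, t • z.2) = t * locFun F a z := by
  rw [locFun, tChart_symm_smul hz.1, hF.homogeneous _ _ _ ht.le]
  rfl

theorem IsGeodesicSpray.isLocalEnergy (hF : IsFinslerMetric F) (hS : IsGeodesicSpray F S) (a : M) :
    IsLocalEnergy (slitTarget E a) (locVec S a) (fun w => locFun F a w ^ 2 / 2) where
  spray := hS.isSpray.isLocalSpray a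
  smooth := ((locFun_smooth hF a).pow 2).div_const 2
  pos z hz := by
    have := hF.pos _ (tChart_symm_mem_slit hz)
    simp only [locFun]
    positivity
  euler z hz := by
    have hd := diffAt_of_smoothOn (isOpen_slitTarget a)
      (((locFun_smooth hF a).pow 2).div_const 2) hz
    rw [fderiv_of_homogeneous hd 2 fun t ht => by rw [hF.locFun_homogeneous hz ht]; ring]
    norm_num
  posDef z hz u hu := hF.posDef a z hz u hu
  eulerLagrange z hz X := hS.eulerLagrange a z hz X

theorem IsSemibasic.isLocalForm {θ : OneForm E M} (hθ : IsSemibasic θ) (a : M) :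
    IsLocalForm (slitTarget E a) (locForm θ a) where
  isOpen := isOpen_slitTarget a
  smooth := hθ.smooth a
  vert := hθ.vert a

theorem isSemibasic_of_locForm_eq {θ : OneForm E M} {η : M → E × E → E × E →L[ℝ] ℝ}
    (h : ∀ a, ∀ z ∈ slitTarget E a, locForm θ a z = η a z)
    (hη : ∀ a, IsLocalForm (slitTarget E a) (η a)) : IsSemibasic θ where
  smooth a := (hη a).smooth.congr (h a)
  vert a z hz w := by rw [h a z hz, (hη a).vert z hz]

theorem IsCurvatureForm.isEulerForm {ξ : OneForm E M} (hξ : IsCurvatureForm S ξ) (a : M) :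
    IsEulerForm (slitTarget E a) (locForm ξ a) := by
  intro z hz v
  have hd := (hξ.semibasic.isLocalForm a).diffAt hz
  rw [← fderiv_clm_apply_const hd, fderiv_of_homogeneous (by fun_prop) 1 fun t ht => by
    rw [hξ.homogeneous a z hz t ht, pow_one]]
  simp

theorem IsCurvatureForm.representsCurv {ξ : OneForm E M} (hS : IsSpray S)
    (hξ : IsCurvatureForm S ξ) (a : M) :
    RepresentsCurv (slitTarget E a) (locVec S a) (locForm ξ a) := by
  intro z hz u v
  have h := hξ.curvature_eq a z hz (u, 0) (v, 0)
  rw [(hS.isLocalSpray a).curvature_apply hz, (hξ.semibasic.isLocalForm a).dForm_vertJ hz] at h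
  simpa [vertJ, liouville] using congrArg Prod.snd h

theorem isCurvatureForm_of_local {ξ : OneForm E M} (hS : IsSpray S) (hξ : IsSemibasic ξ)
    (he : ∀ a, IsEulerForm (slitTarget E a) (locForm ξ a))
    (hR : ∀ a, RepresentsCurv (slitTarget E a) (locVec S a) (locForm ξ a)) :
    IsCurvatureForm S ξ where
  semibasic := hξ
  homogeneous a z hz t ht u := by
    have hd : ∀ s : ℝ, 0 < s → DifferentiableAt ℝ (locForm ξ a) (z.1, s • z.2) := fun s hs =>
      (hξ.isLocalForm a).diffAt (smul_mem_slitTarget hz hs)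
    refine homogeneous_of_fderiv (f := fun w => locForm ξ a w (u, 0))
      (fun s hs => (hd s hs).clm_apply (differentiableAt_const _)) (fun s hs => ?_) ht
    rw [fderiv_clm_apply_const (hd s hs)]
    exact he a _ (smul_mem_slitTarget hz hs) u
  curvature_eq a z hz X Y := by
    rw [(hS.isLocalSpray a).curvature_apply hz, (hξ.isLocalForm a).dForm_vertJ hz, hR a z hz,
      (hξ.isLocalForm a).apply_eq hz X, (hξ.isLocalForm a).apply_eq hz Y]
    simp [vertJ, liouville]

theorem djVanishes_iff {ξ : OneForm E M} (hξ : IsSemibasic ξ) :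
    DJVanishes ξ ↔ ∀ a : M, ∀ z ∈ slitTarget E a, ∀ u v, dj (locForm ξ a) z u v = 0 := by
  refine forall_congr' fun a => forall₂_congr fun z hz => ?_
  simp only [(hξ.isLocalForm a).dForm_vertJ hz]
  exact ⟨fun h u v => h (u, 0) (v, 0), fun h X Y => h _ _⟩

theorem dhVanishes_iff {ξ : OneForm E M} (hS : IsSpray S) (hξ : IsSemibasic ξ) :
    DHVanishes S ξ
      ↔ ∀ a : M, ∀ z ∈ slitTarget E a, ∀ u v, dh (locVec S a) (locForm ξ a) z u v = 0 := by
  refine forall_congr' fun a => forall₂_congr fun z hz => ?_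
  simp only [(hξ.isLocalForm a).dForm_horProj (hS.isLocalSpray a) hz]
  exact ⟨fun h u v => h (u, 0) (v, 0), fun h X Y => h _ _⟩

theorem isIsotropic_iff [FiniteDimensional ℝ E] (hn : 1 < finrank ℝ E) (hS : IsSpray S) :
    IsIsotropic S ↔ ∃ α : OneForm E M, IsSemibasic α ∧ ∀ a : M, ∀ z ∈ slitTarget E a, ∀ v : E,
      curv (locVec S a) z z.2 v = locForm α a z (z.2, 0) • v - locForm α a z (v, 0) • z.2 := by
  refine exists_congr fun α => and_congr_right fun hα => forall_congr' fun a =>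
    forall₂_congr fun z hz => ?_
  have h := hS.isLocalSpray a
  refine ⟨fun hiso v => ?_, fun hiso X => ?_⟩
  · have e : ∀ v, curv (locVec S a) z z.2 v
        = ricciScalar (locVec S a) z • v - locForm α a z (v, 0) • z.2 := fun v => by
      have := hiso (v, 0)
      rw [h.jacobiEndo_apply hz] at this
      simpa [vertJ, liouville] using congrArg Prod.snd this
    have e1 := e z.2
    rw [curv_self, ← sub_smul, eq_comm] at e1
    rw [← sub_eq_zero.1 ((smul_eq_zero.1 e1).resolve_right (h.ne_zero z hz))]
    exact e v
  · have hρ := h.ricciScalar_eq hn hz _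
      ((locForm α a z).toLinearMap ∘ₗ LinearMap.inl ℝ E E) hiso rfl
    rw [h.jacobiEndo_apply hz, hρ, hiso, (hα.isLocalForm a).apply_eq hz X]
    simp [vertJ, liouville]

theorem hasConstantFlagCurvature_iff (hF : IsFinslerMetric F) (hS : IsSpray S) :
    HasConstantFlagCurvature F S ↔ ∃ κ : ℝ, ∀ a : M, ∀ z ∈ slitTarget E a, ∀ v : E,
      curv (locVec S a) z z.2 v = (κ * (2 * (locFun F a z ^ 2 / 2))) • v
        - (κ * fderiv ℝ (fun w => locFun F a w ^ 2 / 2) z (0, v)) • z.2 := by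
  refine exists_congr fun κ => forall_congr' fun a => forall₂_congr fun z hz => ?_
  have h := hS.isLocalSpray a
  have hd := diffAt_of_smoothOn (isOpen_slitTarget a) (locFun_smooth hF a) hz
  simp only [h.jacobiEndo_apply hz, dFun_vertJ_apply, fderiv_energy hd]
  refine ⟨fun hc v => ?_, fun hc X => ?_⟩
  · have := congrArg Prod.snd (hc (v, 0))
    simp only [vertJ, liouville] at this
    refine this.trans ?_
    simp
    module
  · rw [hc]
    simp [vertJ, liouville]
    module

/-- A function on the slit tangent bundle of a connected manifold with zero derivative is constant.
The fibres `E ∖ {0}` are connected because `dim E > 1`. -/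
theorem exists_const_of_fderiv_eq_zero [FiniteDimensional ℝ E] [ConnectedSpace M]
    (hn : 1 < finrank ℝ E) (k : M → E × E → ℝ)
    (hk : ∀ a b : M, ∀ z ∈ overlap E a b, k b (tChange E a b z) = k a z)
    (hd : ∀ a, ∀ z ∈ slitTarget E a, DifferentiableAt ℝ (k a) z)
    (h0 : ∀ a, ∀ z ∈ slitTarget E a, fderiv ℝ (k a) z = 0) :
    ∃ κ : ℝ, ∀ a, ∀ z ∈ slitTarget E a, k a z = κ := by
  have : Nontrivial E := Module.nontrivial_of_finrank_pos (R := ℝ) (by omega)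
  obtain ⟨e, he⟩ := exists_ne (0 : E)
  have hpre : IsPreconnected ({y | y ≠ 0} : Set E) := by
    refine (isConnected_compl_singleton_of_one_lt_rank ?_ 0).isPreconnected
    rw [← Module.finrank_eq_rank]
    exact_mod_cast hn
  have hcon : ∀ a : M, ∀ x ∈ (extChartAt 𝓘(ℝ, E) a).target, ∃ B : Set E, IsOpen B ∧ x ∈ B ∧
      B ⊆ (extChartAt 𝓘(ℝ, E) a).target ∧ ∀ x' ∈ B, ∀ y y' : E, y ≠ 0 → y' ≠ 0 →
        k a (x', y') = k a (x, y) := by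
    intro a x hx
    obtain ⟨ε, hε, hB⟩ := Metric.isOpen_iff.1 (isOpen_extChartAt_target (I := 𝓘(ℝ, E)) a) x hx
    have hsub : Metric.ball x ε ×ˢ {y : E | y ≠ 0} ⊆ slitTarget E a := by
      rw [slitTarget_eq]
      exact prod_mono_left hB
    refine ⟨Metric.ball x ε, Metric.isOpen_ball, Metric.mem_ball_self hε, hB, ?_⟩
    intro x' hx' y y' hy hy'
    exact (Metric.isOpen_ball.prod isOpen_ne).is_const_of_fderiv_eq_zero
      ((convex_ball x ε).isPreconnected.prod hpre)
      (fun z hz => (hd a z (hsub hz)).differentiableWithinAt) (fun z hz => h0 a z (hsub hz))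
      ⟨hx', hy'⟩ ⟨Metric.mem_ball_self hε, hy⟩
  let g : M → ℝ := fun m => k m (extChartAt 𝓘(ℝ, E) m m, e)
  -- `k` may be computed in any chart, in any direction
  have hg : ∀ a, ∀ z ∈ slitTarget E a, k a z = g ((extChartAt 𝓘(ℝ, E) a).symm z.1) := by
    intro a z hz
    have hs := mem_tChart_source_self ((tChart E a).symm z)
    rw [← tChart_symm_fst, ← hk a _ z ⟨hz, hs⟩]
    have hz' := tChange_mapsTo a _ (x := z) ⟨hz, hs⟩
    have hfst : (tChange E a ((tChart E a).symm z).1 z).1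
        = extChartAt 𝓘(ℝ, E) ((tChart E a).symm z).1 ((tChart E a).symm z).1 := by
      rw [tChange, tChart_apply]
    obtain ⟨B, -, hx, -, hB⟩ := hcon ((tChart E a).symm z).1 _ (mem_extChartAt_target _)
    have := hB _ hx e _ he hz'.2
    rw [← hfst] at this
    exact this.trans (congrArg (fun x => k _ (x, e)) hfst)
  have hloc : IsLocallyConstant g := by
    refine (IsLocallyConstant.iff_exists_open g).2 fun m => ?_
    obtain ⟨B, hBo, hx, hBt, hB⟩ := hcon m _ (mem_extChartAt_target (I := 𝓘(ℝ, E)) m)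
    refine ⟨(extChartAt 𝓘(ℝ, E) m).source ∩ extChartAt 𝓘(ℝ, E) m ⁻¹' B,
      (continuousOn_extChartAt m).isOpen_inter_preimage (isOpen_extChartAt_source m) hBo,
      ⟨mem_extChartAt_source m, hx⟩, fun m' hm' => ?_⟩
    have h1 := hg m (extChartAt 𝓘(ℝ, E) m m', e) (by
      rw [slitTarget_eq]
      exact ⟨hBt hm'.2, he⟩)
    simp only [(extChartAt 𝓘(ℝ, E) m).left_inv hm'.1] at h1
    rw [← h1, hB _ hm'.2 e e he he]
  obtain ⟨m⟩ := ConnectedSpace.toNonempty (α := M)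
  exact ⟨g m, fun a z hz => (hg a z hz).trans (hloc.apply_eq_of_preconnectedSpace _ _)⟩

end Bridge

/-! ### Curvature forms on the slit tangent bundle -/

section Main

variable {E : Type*} [NormedAddCommGroup E] [NormedSpace ℝ E] [FiniteDimensional ℝ E]
  {M : Type*} [TopologicalSpace M] [ChartedSpace E M] [IsManifold 𝓘(ℝ, E) ∞ M]
  {S : VecField E M} {F : TangentBundle 𝓘(ℝ, E) M → ℝ}

theorem IsCurvatureForm.unique (hn : 1 < finrank ℝ E) (hS : IsSpray S) {ξ ξ' : OneForm E M}
    (hξ : IsCurvatureForm S ξ) (hξ' : IsCurvatureForm S ξ') {p : TangentBundle 𝓘(ℝ, E) M}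
    (hp : p ∈ slit E M) : ξ p = ξ' p := by
  have hs := mem_tChart_source_self p
  exact oneForm_eq_of_locForm_eq hs (RepresentsCurv.unique hn (hS.isLocalSpray p.1)
    (hξ.semibasic.isLocalForm p.1) (hξ'.semibasic.isLocalForm p.1) (hξ.isEulerForm p.1)
    (hξ'.isEulerForm p.1) (hξ.representsCurv hS p.1) (hξ'.representsCurv hS p.1)
    (tChart_mem_slitTarget hs hp))

/-- A form `ξ` with `3 ξ = α + d_J (α (S))`, where `Φ = α (S) J - α ⊗ C`, is a curvature form. -/
theorem isCurvatureForm_of_isotropic (hn : 1 < finrank ℝ E) (hS : IsSpray S) {α ξ : OneForm E M}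
    (hα : IsSemibasic α) (hξ : IsSemibasic ξ)
    (hiso : ∀ a : M, ∀ z ∈ slitTarget E a, ∀ v : E,
      curv (locVec S a) z z.2 v = locForm α a z (z.2, 0) • v - locForm α a z (v, 0) • z.2)
    (hdef : ∀ a : M, ∀ z ∈ slitTarget E a, ∀ v : E, 3 * locForm ξ a z (v, 0)
      = locForm α a z (v, 0) + fderiv ℝ (fun w => locForm α a w (w.2, 0)) z (0, v)) :
    IsCurvatureForm S ξ :=
  isCurvatureForm_of_local hS hξ
    (fun a => isEulerForm_of_isotropic hn (hS.isLocalSpray a) (hα.isLocalForm a)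
      (hξ.isLocalForm a) (hiso a) (hdef a))
    (fun a => representsCurv_of_isotropic (hS.isLocalSpray a) (hα.isLocalForm a)
      (hξ.isLocalForm a) (hiso a) (hdef a))

omit [FiniteDimensional ℝ E] in
/-- The contraction of a semi-basic 1-form with a spray does not depend on the chart. -/
theorem IsSemibasic.contract_change (hS : IsSpray S) {α : OneForm E M} (hα : IsSemibasic α)
    {a b : M} {z : E × E} (hz : z ∈ overlap E a b) :
    locForm α b (tChange E a b z) ((tChange E a b z).2, 0) = locForm α a z (z.2, 0) := by
  have e : ∀ c, ∀ w ∈ slitTarget E c, locForm α c w (locVec S c w) = locForm α c w (w.2, 0) :=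
    fun c w hw => by
      rw [(hα.isLocalForm c).apply_eq hw, (hS.isLocalSpray c).fst_eq w hw]
  rw [← e a z hz.1, ← e b _ (tChange_mapsTo a b hz), locVec_change S hz, locForm_change α hz]

/-- For `Φ = ρ J - α ⊗ C`, the local forms `(α + d_J ρ) / 3` glue, since `ρ = α (S)`. -/
theorem IsIsotropic.exists_isCurvatureForm (hn : 1 < finrank ℝ E) (hS : IsSpray S)
    (h : IsIsotropic S) : ∃ ξ : OneForm E M, IsCurvatureForm S ξ := by
  obtain ⟨α, hα, hiso⟩ := (isIsotropic_iff hn hS).1 h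
  let ρ : M → E × E → ℝ := fun a w => locForm α a w (w.2, 0)
  have hρ : ∀ a, ContDiffOn ℝ ∞ (ρ a) (slitTarget E a) := fun a =>
    (hα.isLocalForm a).smooth_contract
  let η : M → E × E → E × E →L[ℝ] ℝ := fun a z =>
    (1 / 3 : ℝ) • (locForm α a z + dFun vertJ (ρ a) z)
  have hη : ∀ a, IsLocalForm (slitTarget E a) (η a) := fun a =>
    { isOpen := isOpen_slitTarget a
      smooth := ((hα.smooth a).add
        (isLocalForm_dFun_vertJ (isOpen_slitTarget a) (hρ a)).smooth).const_smul _
      vert := fun z hz w => by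
        simp only [η, _root_.smul_apply, _root_.add_apply, hα.vert a z hz,
          (isLocalForm_dFun_vertJ (isOpen_slitTarget a) (hρ a)).vert z hz, add_zero, smul_zero] }
  have hloc : ∀ a, ∀ z ∈ slitTarget E a, locForm (glue η) a z = η a z := fun a z hz => by
    refine locForm_glue (fun a b w hw X => ?_) hz
    have hd := diffAt_of_smoothOn (isOpen_slitTarget b) (hρ b) (tChange_mapsTo a b hw)
    simp only [η, _root_.smul_apply, _root_.add_apply, locForm_change α hw,
      (isInducedChange a b).dFun_vertJ_natural (f := ρ a)
        (fun p hp => hα.contract_change hS hp) hw hd]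
  refine ⟨glue η, isCurvatureForm_of_isotropic hn hS hα (isSemibasic_of_locForm_eq hloc hη) hiso
    fun a z hz v => ?_⟩
  rw [hloc a z hz]
  simp only [η, _root_.smul_apply, _root_.add_apply, dFun_vertJ_apply, smul_eq_mul]
  ring

omit [FiniteDimensional ℝ E] in
/-- The multiple `f d_J L` of the Hilbert form `d_J L`, for a function `f` given in the induced
charts, is a semi-basic 1-form. -/
theorem exists_form_eq_mul_dFun (hF : IsFinslerMetric F) (hS : IsGeodesicSpray F S)
    (f : M → E × E → ℝ) (hf : ∀ a, ContDiffOn ℝ ∞ (f a) (slitTarget E a))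
    (hfc : ∀ a b : M, ∀ z ∈ overlap E a b, f b (tChange E a b z) = f a z) :
    ∃ α : OneForm E M, IsSemibasic α ∧ ∀ a, ∀ z ∈ slitTarget E a,
      locForm α a z = f a z • dFun vertJ (fun w => locFun F a w ^ 2 / 2) z := by
  let η : M → E × E → E × E →L[ℝ] ℝ := fun a z =>
    f a z • dFun vertJ (fun w => locFun F a w ^ 2 / 2) z
  have hη : ∀ a, IsLocalForm (slitTarget E a) (η a) := fun a =>
    { isOpen := isOpen_slitTarget a
      smooth := (hf a).smul (hS.isLocalEnergy hF a).isLocalForm.smooth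
      vert := fun z hz w => by
        simp only [η, _root_.smul_apply, (hS.isLocalEnergy hF a).isLocalForm.vert z hz, smul_zero] }
  have hloc : ∀ a, ∀ z ∈ slitTarget E a, locForm (glue η) a z = η a z := fun a z hz => by
    refine locForm_glue (fun a b w hw X => ?_) hz
    simp only [η, _root_.smul_apply, hfc a b w hw,
      (isInducedChange a b).dFun_vertJ_natural (f := fun w => locFun F a w ^ 2 / 2)
        (fun p hp => by rw [locFun_change F hp]) hw
        ((hS.isLocalEnergy hF b).diffAt (tChange_mapsTo a b hw))]
  exact ⟨glue η, isSemibasic_of_locForm_eq hloc hη, hloc⟩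

/-- In dimension two the form `α` is `(ρ / 2 L) d_J L`. -/
theorem IsGeodesicSpray.isIsotropic_of_finrank_eq_two (hF : IsFinslerMetric F)
    (hS : IsGeodesicSpray F S) (hn : finrank ℝ E = 2) : IsIsotropic S := by
  have hL : ∀ a, ∀ z ∈ slitTarget E a, 2 * (locFun F a z ^ 2 / 2) ≠ 0 := fun a z hz => by
    have := (hS.isLocalEnergy hF a).pos z hz
    positivity
  obtain ⟨α, hα, hloc⟩ := exists_form_eq_mul_dFun hF hS
    (fun a z => ricciScalar (locVec S a) z / (2 * (locFun F a z ^ 2 / 2)))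
    (fun a => (hS.isSpray.isLocalSpray a).smooth_ricciScalar.div
      (contDiffOn_const.mul (hS.isLocalEnergy hF a).smooth) (hL a))
    (fun a b z hz => by
      simp only [locFun_change F hz]
      rw [(isInducedChange a b).ricciScalar_natural (fun w hw => hw.1)
        (hS.isSpray.isLocalSpray a) (hS.isSpray.isLocalSpray b)
        (fun w hw => locVec_change S hw) hz])
  refine (isIsotropic_iff (by omega) hS.isSpray).2 ⟨α, hα, fun a z hz v => ?_⟩
  have h := hS.isLocalEnergy hF a
  rw [h.curv_of_finrank_eq_two hn hz, hloc a z hz]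
  simp only [_root_.smul_apply, dFun_vertJ_apply, smul_eq_mul]
  rw [h.euler z hz, div_mul_cancel₀ _ (hL a z hz), div_mul_eq_mul_div]

/-- Constant flag curvature `κ` gives the curvature form `κ d_J L`. -/
theorem HasConstantFlagCurvature.exists_isCurvatureForm (hn : 1 < finrank ℝ E)
    (hF : IsFinslerMetric F) (hS : IsGeodesicSpray F S) (h : HasConstantFlagCurvature F S) :
    IsIsotropic S ∧ ∃ ξ : OneForm E M, IsCurvatureForm S ξ ∧ DJVanishes ξ ∧ DHVanishes S ξ := by
  obtain ⟨κ, hκ⟩ := (hasConstantFlagCurvature_iff hF hS.isSpray).1 h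
  obtain ⟨ξ, hξ, hloc⟩ := exists_form_eq_mul_dFun hF hS (fun _ _ => κ) (fun _ => contDiffOn_const)
    (fun _ _ _ _ => rfl)
  have hval : ∀ a, ∀ z ∈ slitTarget E a, ∀ v : E, locForm ξ a z (v, 0)
      = κ * fderiv ℝ (fun w => locFun F a w ^ 2 / 2) z (0, v) := fun a z hz v => by
    rw [hloc a z hz]
    simp only [_root_.smul_apply, dFun_vertJ_apply, smul_eq_mul]
  have hcon : ∀ a, ∀ z ∈ slitTarget E a, locForm ξ a z (z.2, 0)
      = κ * (2 * (locFun F a z ^ 2 / 2)) := fun a z hz => by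
    rw [hval a z hz, (hS.isLocalEnergy hF a).euler z hz]
  have hiso : ∀ a : M, ∀ z ∈ slitTarget E a, ∀ v : E,
      curv (locVec S a) z z.2 v = locForm ξ a z (z.2, 0) • v - locForm ξ a z (v, 0) • z.2 :=
    fun a z hz v => by rw [hκ a z hz, hcon a z hz, hval a z hz]
  have hd : ∀ a, ∀ z ∈ slitTarget E a, ∀ X, fderiv ℝ (locForm ξ a) z X
      = κ • fderiv ℝ (dFun vertJ (fun w => locFun F a w ^ 2 / 2)) z X := fun a z hz X => by
    rw [fderiv_eq_of_eqOn (isOpen_slitTarget a) (hloc a) hz,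
      fderiv_fun_const_smul ((hS.isLocalEnergy hF a).isLocalForm.diffAt hz)]
    rfl
  refine ⟨(isIsotropic_iff hn hS.isSpray).2 ⟨ξ, hξ, hiso⟩, ξ,
    isCurvatureForm_of_isotropic hn hS.isSpray hξ hξ hiso fun a z hz v => ?_,
    (djVanishes_iff hξ).2 fun a z hz u v => ?_,
    (dhVanishes_iff hS.isSpray hξ).2 fun a z hz u v => ?_⟩
  · have hL := (hS.isLocalEnergy hF a).diffAt hz
    rw [fderiv_eq_of_eqOn (isOpen_slitTarget a) (hcon a) hz, fderiv_const_mul (by fun_prop),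
      fderiv_const_mul hL, hval a z hz]
    simp only [_root_.smul_apply, smul_eq_mul]
    ring
  · have := (hS.isLocalEnergy hF a).dj_dFun hz u v
    simp only [dj, hd a z hz, _root_.smul_apply, ← smul_sub] at this ⊢
    rw [this, smul_zero]
  · have := (hS.isLocalEnergy hF a).dh_dFun hz u v
    simp only [dh, hd a z hz, _root_.smul_apply, ← smul_sub] at this ⊢
    rw [this, smul_zero]

/-- The factor `κ` in `ξ = κ d_J L` is locally constant, hence constant, and is the flag
curvature. -/
theorem IsCurvatureForm.hasConstantFlagCurvature [ConnectedSpace M] (hn : 1 < finrank ℝ E)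
    (hF : IsFinslerMetric F) (hS : IsGeodesicSpray F S) {ξ : OneForm E M}
    (hξ : IsCurvatureForm S ξ) (hj : DJVanishes ξ) (hh : DHVanishes S ξ) :
    HasConstantFlagCurvature F S := by
  have hj' := (djVanishes_iff hξ.semibasic).1 hj
  have hh' := (dhVanishes_iff hS.isSpray hξ.semibasic).1 hh
  have hL : ∀ a, ∀ z ∈ slitTarget E a, 2 * (locFun F a z ^ 2 / 2) ≠ 0 := fun a z hz => by
    have := (hS.isLocalEnergy hF a).pos z hz
    positivity
  obtain ⟨κ, hκ⟩ := exists_const_of_fderiv_eq_zero hn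
    (fun a z => locForm ξ a z (z.2, 0) / (2 * (locFun F a z ^ 2 / 2)))
    (fun a b z hz => by simp only [hξ.semibasic.contract_change hS.isSpray hz, locFun_change F hz])
    (fun a z hz => diffAt_of_smoothOn (isOpen_slitTarget a)
      ((hξ.semibasic.isLocalForm a).smooth_contract.div
        (contDiffOn_const.mul (hS.isLocalEnergy hF a).smooth) (hL a)) hz)
    (fun a z hz => (hS.isLocalEnergy hF a).fderiv_factor hn (hξ.semibasic.isLocalForm a)
      (hξ.isEulerForm a) (hξ.representsCurv hS.isSpray a) (hj' a) (hh' a) hz)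
  refine (hasConstantFlagCurvature_iff hF hS.isSpray).2 ⟨κ, fun a z hz v => ?_⟩
  have h1 := (hS.isLocalEnergy hF a).eq_factor_mul (hξ.representsCurv hS.isSpray a) (hj' a) hz v
  rw [hκ a z hz] at h1
  rw [(hξ.representsCurv hS.isSpray a).curv_snd hz, hj' a z hz, add_zero, h1, ← hκ a z hz,
    div_mul_cancel₀ _ (hL a z hz)]

end Main

end Finsler

end

theorem mainTheorem1
    {E : Type*} [NormedAddCommGroup E] [NormedSpace ℝ E] [FiniteDimensional ℝ E]
    {M : Type*} [TopologicalSpace M] [ChartedSpace E M] [IsManifold 𝓘(ℝ, E) ∞ M]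
    [ConnectedSpace M]
    (hn : 1 < Module.finrank ℝ E)
    (F : TangentBundle 𝓘(ℝ, E) M → ℝ) (hF : Finsler.IsFinslerMetric F)
    (S : Finsler.VecField E M) (hS : Finsler.IsGeodesicSpray F S) :
    (Finsler.IsIsotropic S →
      ∃ ξ : Finsler.OneForm E M, Finsler.IsCurvatureForm S ξ ∧
        ∀ ξ' : Finsler.OneForm E M, Finsler.IsCurvatureForm S ξ' →
          ∀ p ∈ Finsler.slit E M, ξ' p = ξ p) ∧
    (Finsler.HasConstantFlagCurvature F S ↔
      Finsler.IsIsotropic S ∧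
        ∃ ξ : Finsler.OneForm E M, Finsler.IsCurvatureForm S ξ ∧
          Finsler.DJVanishes ξ ∧ Finsler.DHVanishes S ξ) ∧
    (Module.finrank ℝ E = 2 → Finsler.IsIsotropic S) ∧
    (2 < Module.finrank ℝ E →
      ∀ ξ : Finsler.OneForm E M, Finsler.IsCurvatureForm S ξ → Finsler.DHVanishes S ξ) := by
  refine ⟨fun hiso => ?_, ⟨fun h => h.exists_isCurvatureForm hn hF hS, ?_⟩,
    hS.isIsotropic_of_finrank_eq_two hF, fun hn' ξ hξ => ?_⟩
  · obtain ⟨ξ, hξ⟩ := hiso.exists_isCurvatureForm hn hS.isSpray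
    exact ⟨ξ, hξ, fun ξ' hξ' p hp => hξ'.unique hn hS.isSpray hξ hp⟩
  · rintro ⟨-, ξ, hξ, hj, hh⟩
    exact hξ.hasConstantFlagCurvature hn hF hS hj hh
  · exact (Finsler.dhVanishes_iff hS.isSpray hξ.semibasic).2 fun a z hz u v =>
      (hξ.representsCurv hS.isSpray a).dh_eq_zero hn' (hS.isSpray.isLocalSpray a)
        (hξ.semibasic.isLocalForm a) (hξ.isEulerForm a) hz u v
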